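/- Let $n\ge 1$ and let $S\subset\mathbb{R}^{n+1}$ be a compact $C^2$ hypersurface that is the boundary of a bounded convex domain. Let $\nu$ denote Euclidean surface measure on $S$. For $v\in\mathbb{R}^{n+1}$ with $|v|=1$ and real $t\neq 0$ put $$a(v,t)=\sup_{s\in\mathbb{R}}\nu\big(\{x\in S:\ s\le x\cdot v\le s+|t|^{-1}\}\big),$$ and for a real-valued function $\psi$ that is $C^1$ on a neighborhood of $S$ in $\mathbb{R}^{n+1}$ put $$\widehat{\psi\nu}(\lambda)=\int_S e^{-i\lambda\cdot x}\,\psi(x)\,d\nu(x),\qquad \lambda\in\mathbb{R}^{n+1}.$$ Let $0<\alpha<1$. 1. Let $\psi$ be a real-valued $C^1$ function on a neighborhood of $S$. If there is a constant $C>0$ such that $a(v,t)\le C|t|^{-\alpha}$ for all $v$ with $|v|=1$ and all $t\ne 0$, then there is a constant $C'$, depending on $S$, $\psi$ and $\alpha$, such that $|\widehat{\psi\nu}(\lambda)|\le C'|\lambda|^{-\alpha}$ for all $\lambda\neq 0$. 2. Conversely, there is a constant $C>0$, depending only on $S$ and $\alpha$, with the following property. If $\psi$ is a real-valued $C^1$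 function on a neighborhood of $S$ with $\psi(x)>0$ for all $x\in S$, and there is a constant $C'$ such that $|\widehat{\psi\nu}(\lambda)|\le C'|\lambda|^{-\alpha}$ for all $\lambda\ne 0$, then $a(v,t)\le C|t|^{-\alpha}$ for all $v$ with $|v|=1$ and all $t\ne 0$. -/

import Mathlib

open MeasureTheory Filter Topology
open scoped ENNReal

/-- `S ⊆ ℝⁿ⁺¹` is an (embedded) `C²` hypersurface: near each of its points `p`, after a rigid motion
`A` of `ℝⁿ⁺¹` onto `ℝⁿ × ℝ` (with the Euclidean norm) that takes `p` to the origin and the tangent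
plane at `p` to `ℝⁿ × {0}`, it is the graph of a `C²` function `f` of the first `n` variables. -/
def IsC2Hypersurface (n : ℕ) (S : Set (EuclideanSpace ℝ (Fin (n + 1)))) : Prop :=
  ∀ p ∈ S,
    ∃ (A : EuclideanSpace ℝ (Fin (n + 1)) ≃ᵃⁱ[ℝ] WithLp 2 (EuclideanSpace ℝ (Fin n) × ℝ))
      (f : EuclideanSpace ℝ (Fin n) → ℝ),
      A p = 0 ∧ ContDiffAt ℝ 2 f 0 ∧ f 0 = 0 ∧ fderiv ℝ f 0 = 0 ∧
        ∀ᶠ x in 𝓝 p, (x ∈ S ↔ (A x).snd = f (A x).fst)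

/-- `S` is the boundary of a bounded convex domain (nonempty convex open set). -/
def BoundsConvexDomain {n : ℕ} (S : Set (EuclideanSpace ℝ (Fin (n + 1)))) : Prop :=
  ∃ Ω : Set (EuclideanSpace ℝ (Fin (n + 1))),
    Ω.Nonempty ∧ IsOpen Ω ∧ Convex ℝ Ω ∧ Bornology.IsBounded Ω ∧ frontier Ω = S

/-- Euclidean surface measure on `S ⊆ ℝⁿ⁺¹`: the `n`-dimensional Hausdorff measure, normalized to
agree with Lebesgue measure on `ℝⁿ`, restricted to `S`. -/
noncomputable def surfaceMeasure {n : ℕ} (S : Set (EuclideanSpace ℝ (Fin (n + 1)))) :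
    Measure (EuclideanSpace ℝ (Fin (n + 1))) :=
  (μHE[n] : Measure (EuclideanSpace ℝ (Fin (n + 1)))).restrict S

/-- `a(v,t)`: the supremum of the surface measure of `{x ∈ S : s ≤ x · v ≤ s + |t|⁻¹}` over all
real `s`, with values in `[0, ∞]`. -/
noncomputable def slabMeasure {n : ℕ} (S : Set (EuclideanSpace ℝ (Fin (n + 1))))
    (v : EuclideanSpace ℝ (Fin (n + 1))) (t : ℝ) : ℝ≥0∞ :=
  ⨆ s : ℝ, surfaceMeasure S {x | x ∈ S ∧ s ≤ inner ℝ x v ∧ inner ℝ x v ≤ s + |t|⁻¹}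

/-- The Fourier transform of `ψ ν` at `ξ`, where `ν` is surface measure on `S`:
`∫_S exp(-i ξ · x) ψ(x) dν(x)`. -/
noncomputable def surfaceFourier {n : ℕ} (S : Set (EuclideanSpace ℝ (Fin (n + 1))))
    (ψ : EuclideanSpace ℝ (Fin (n + 1)) → ℝ) (ξ : EuclideanSpace ℝ (Fin (n + 1))) : ℂ :=
  ∫ x, Complex.exp (-Complex.I * ((inner ℝ ξ x : ℝ) : ℂ)) * (ψ x : ℂ) ∂(surfaceMeasure S)

/-- `a(v,t) ≤ C |t|^{-α}` for all directions `v` and all `t ≠ 0`. -/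
def SlabBound {n : ℕ} (S : Set (EuclideanSpace ℝ (Fin (n + 1)))) (α C : ℝ) : Prop :=
  ∀ v : EuclideanSpace ℝ (Fin (n + 1)), ‖v‖ = 1 → ∀ t : ℝ, t ≠ 0 →
    slabMeasure S v t ≤ ENNReal.ofReal (C * |t| ^ (-α))

/-- `|(ψ ν)^(ξ)| ≤ C' |ξ|^{-α}` for all `ξ ≠ 0`. -/
def FourierBound {n : ℕ} (S : Set (EuclideanSpace ℝ (Fin (n + 1))))
    (ψ : EuclideanSpace ℝ (Fin (n + 1)) → ℝ) (α C' : ℝ) : Prop :=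
  ∀ ξ : EuclideanSpace ℝ (Fin (n + 1)), ξ ≠ 0 → ‖surfaceFourier S ψ ξ‖ ≤ C' * ‖ξ‖ ^ (-α)

/-- `ψ` is `C¹` on a neighborhood of `S` (its values off that neighborhood play no role). -/
def IsC1Near {n : ℕ} (S : Set (EuclideanSpace ℝ (Fin (n + 1))))
    (ψ : EuclideanSpace ℝ (Fin (n + 1)) → ℝ) : Prop :=
  ∃ U : Set (EuclideanSpace ℝ (Fin (n + 1))), IsOpen U ∧ S ⊆ U ∧ ContDiffOn ℝ 1 ψ U

/-!
Near each of its points `S` is the graph of a convex or concave `C²` function, so in graph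
coordinates the phase `λ · x` is, up to sign, a convex function `g`. Let `x₀` be a minimum of `g` on
a closed ball containing the support of the amplitude and `∂` the derivative along `x ↦ x - x₀`.
Then `∂g ≥ 0`, and integrating `exp (i g)` by parts against the damping factor `(1 + ∂g)⁻¹` costs
one derivative of the amplitude and one of the damping factor. By convexity the latter decreases
along rays from `x₀`, so its derivative has a sign and a second integration by parts moves it to a
cutoff; this is why `C²` regularity of `S` and `C¹` regularity of `ψ` suffice. Since
`∂g ≥ g - g x₀`, what remains is the integral of `(1 + g - g x₀)⁻¹`, and by the layer-cake formula
the slab bound makes it `O(|λ|^{-α})`.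

Conversely, put `u x = |t| (x · v - s)` and average the Fourier bounds for the phases `ξ u` over a
Gaussian `ξ` of variance `2`, for which `|ξ|^{-α}` is integrable. This gives
`∫ exp (-u²) ψ dν = O(|t|^{-α})`, and the integrand is bounded below on the slab `0 ≤ u ≤ 1`.
-/

/-! ### The area formula -/

section AreaFormula

open Measure Module

theorem euclideanHausdorffMeasure_image_le_of_dist_le {X Y Z : Type*} [MetricSpace X]
    [MeasurableSpace X] [BorelSpace X] [MetricSpace Y] [MeasurableSpace Y] [BorelSpace Y]
    {Φ : Z → X} {Ψ : Z → Y} {s : Set Z} {K : NNReal} (d : ℕ)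
    (h : ∀ x ∈ s, ∀ y ∈ s, dist (Φ x) (Φ y) ≤ K * dist (Ψ x) (Ψ y)) :
    μHE[d] (Φ '' s) ≤ (K : ℝ≥0∞) ^ d * μHE[d] (Ψ '' s) := by
  rcases s.eq_empty_or_nonempty with rfl | ⟨z, -⟩
  · simp
  have : Nonempty Z := ⟨z⟩
  have factor : Φ '' s = (Φ ∘ Function.invFunOn Ψ s) '' (Ψ '' s) := by
    rw [Set.image_image]
    refine Set.image_congr fun x hx => ?_
    have hm : Ψ x ∈ Ψ '' s := Set.mem_image_of_mem _ hx
    have := h x hx _ (Function.invFunOn_mem hm)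
    rw [Function.invFunOn_eq hm, dist_self, mul_zero] at this
    simpa using dist_le_zero.mp this
  have lipschitz : LipschitzOnWith K (Φ ∘ Function.invFunOn Ψ s) (Ψ '' s) := by
    refine LipschitzOnWith.of_dist_le_mul fun a ha b hb => ?_
    have := h _ (Function.invFunOn_mem ha) _ (Function.invFunOn_mem hb)
    rwa [Function.invFunOn_eq ha, Function.invFunOn_eq hb] at this
  have hausdorff := lipschitz.hausdorffMeasure_image_le (d := d) (by positivity)
  rw [ENNReal.rpow_natCast] at hausdorff
  rw [factor, euclideanHausdorffMeasure_def, euclideanHausdorffMeasure_def, Measure.smul_apply,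
    Measure.smul_apply, mul_smul_comm]
  gcongr

theorem measure_le_mul_of_locally_le_mul {E : Type*} [TopologicalSpace E]
    [SecondCountableTopology E] [MeasurableSpace E] [OpensMeasurableSpace E] {μ ν : Measure E}
    {c : ℝ≥0∞} (h : ∀ x, ∃ V, IsOpen V ∧ x ∈ V ∧ ∀ s ⊆ V, MeasurableSet s → μ s ≤ c * ν s)
    {s : Set E} (hs : MeasurableSet s) : μ s ≤ c * ν s := by
  rcases s.eq_empty_or_nonempty with rfl | ⟨x₀, -⟩
  · simp
  have : Nonempty E := ⟨x₀⟩
  choose V hVo hVx hV using h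
  obtain ⟨t, htc, ht⟩ := TopologicalSpace.countable_cover_nhds fun x =>
    (hVo x).mem_nhds (hVx x)
  have ht₀ : t.Nonempty := by
    by_contra! hempty
    exact Set.empty_ne_univ (by simpa [hempty] using ht)
  obtain ⟨e, rfl⟩ := htc.exists_eq_range ht₀
  rw [Set.biUnion_range] at ht
  let D := disjointed fun i => V (e i)
  have hD : ∀ i, MeasurableSet (s ∩ D i) := fun i =>
    hs.inter (MeasurableSet.disjointed (fun i => (hVo (e i)).measurableSet) i)
  have cover : s = ⋃ i, s ∩ D i := by
    rw [← Set.inter_iUnion, iUnion_disjointed, ht, Set.inter_univ]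
  have disj : Pairwise (Function.onFun Disjoint fun i => s ∩ D i) := fun i j hij =>
    (disjoint_disjointed _ hij).mono Set.inter_subset_right Set.inter_subset_right
  rw [cover, measure_iUnion disj hD, measure_iUnion disj hD, ← ENNReal.tsum_mul_left]
  exact ENNReal.tsum_le_tsum fun i =>
    hV _ _ (Set.inter_subset_right.trans (disjointed_subset _ i)) (hD i)

theorem measure_le_of_locally_le_mul {E : Type*} [TopologicalSpace E] [SecondCountableTopology E]
    [MeasurableSpace E] [OpensMeasurableSpace E] {μ ν : Measure E}
    (h : ∀ c : ℝ≥0∞, 1 < c → ∀ x, ∃ V, IsOpen V ∧ x ∈ V ∧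
      ∀ s ⊆ V, MeasurableSet s → μ s ≤ c * ν s) : μ ≤ ν := by
  refine Measure.le_iff.2 fun s hs => ?_
  have lim : Tendsto (fun c : ℝ≥0∞ => c * ν s) (𝓝[>] 1) (𝓝 (1 * ν s)) :=
    (ENNReal.Tendsto.mul_const tendsto_id (Or.inl one_ne_zero)).mono_left nhdsWithin_le_nhds
  rw [one_mul] at lim
  exact ge_of_tendsto lim (eventually_nhdsWithin_of_forall fun c hc =>
    measure_le_mul_of_locally_le_mul (h c hc) hs)

theorem norm_le_mul_of_norm_sub_le {V : Type*} [SeminormedAddCommGroup V] {a b : V} {K : ℝ}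
    (hK : 1 ≤ K) (h : ‖a - b‖ ≤ (1 - K⁻¹) * ‖b‖) : ‖a‖ ≤ K * ‖b‖ ∧ ‖b‖ ≤ K * ‖a‖ := by
  have hinv : K * K⁻¹ = 1 := mul_inv_cancel₀ (by positivity)
  have hab := norm_le_norm_add_norm_sub b a
  have hba := norm_le_norm_add_norm_sub' b a
  rw [norm_sub_rev b a] at hab hba
  have two_sub : 2 - K⁻¹ ≤ K := by nlinarith [sq_nonneg (K - 1), inv_pos.2 (by positivity : 0 < K)]
  have lower : K⁻¹ * ‖b‖ ≤ ‖a‖ := by linarith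
  constructor
  · linarith [mul_le_mul_of_nonneg_right two_sub (norm_nonneg b)]
  · calc ‖b‖ = K * (K⁻¹ * ‖b‖) := by rw [← mul_assoc, hinv, one_mul]
      _ ≤ K * ‖a‖ := by gcongr

theorem exists_one_lt_pow_le {c : ℝ≥0∞} (hc : 1 < c) (n : ℕ) :
    ∃ K : NNReal, 1 < K ∧ (K : ℝ≥0∞) ^ n ≤ c := by
  have hcont : Continuous fun K : NNReal => ((K ^ n : NNReal) : ℝ≥0∞) := by fun_prop
  have hlim : Tendsto (fun K : NNReal => ((K ^ n : NNReal) : ℝ≥0∞)) (𝓝[>] 1) (𝓝 1) := by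
    simpa using (hcont.tendsto 1).mono_left nhdsWithin_le_nhds
  obtain ⟨K, hKc, hK⟩ := ((hlim.eventually (eventually_le_nhds hc)).and self_mem_nhdsWithin).exists
  exact ⟨K, hK, by exact_mod_cast hKc⟩

variable {E V : Type*} [NormedAddCommGroup E] [InnerProductSpace ℝ E] [FiniteDimensional ℝ E]
  [NormedAddCommGroup V] [InnerProductSpace ℝ V]

theorem exists_isOpen_comparable_of_continuousAt {Φ : E → V} {Φ' : E → E →L[ℝ] V} {x : E}
    (hΦ : ∀ᶠ y in 𝓝 x, HasFDerivAt Φ (Φ' y) y) (hΦ' : ContinuousAt Φ' x)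
    (hinj : Function.Injective (Φ' x)) {K : ℝ} (hK : 1 < K) :
    ∃ W, IsOpen W ∧ x ∈ W ∧
      (∀ y ∈ W, ∀ z ∈ W, ‖Φ y - Φ z‖ ≤ K * ‖Φ' x (y - z)‖ ∧ ‖Φ' x (y - z)‖ ≤ K * ‖Φ y - Φ z‖) ∧
      ∀ y ∈ W, ∀ v, ‖Φ' y v‖ ≤ K * ‖Φ' x v‖ ∧ ‖Φ' x v‖ ≤ K * ‖Φ' y v‖ := by
  obtain ⟨c, hc, hanti⟩ := (Φ' x).toLinearMap.exists_antilipschitzWith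
    (LinearMap.ker_eq_bot.2 hinj)
  have expand : ∀ v, ‖v‖ ≤ c * ‖Φ' x v‖ := fun v => by
    simpa using hanti.le_mul_dist v 0
  obtain ⟨ε, hε, hεK⟩ : ∃ ε : NNReal, 0 < ε ∧ (ε : ℝ) * c = 1 - K⁻¹ := by
    have : 0 < 1 - K⁻¹ := sub_pos.2 (inv_lt_one_of_one_lt₀ hK)
    refine ⟨(1 - K⁻¹).toNNReal / c, div_pos (Real.toNNReal_pos.2 this) hc, ?_⟩
    rw [NNReal.coe_div, Real.coe_toNNReal _ this.le]
    exact div_mul_cancel₀ _ (by exact_mod_cast hc.ne')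
  have scale : ∀ {r : ℝ} {v}, r ≤ ε * ‖v‖ → r ≤ (1 - K⁻¹) * ‖Φ' x v‖ := fun {r v} h => by
    rw [← hεK, mul_assoc]
    exact h.trans (by gcongr; exact expand v)
  obtain ⟨N, hN, hlin⟩ :=
    (hasStrictFDerivAt_of_hasFDerivAt_of_continuousAt hΦ hΦ').approximates_deriv_on_nhds
      (c := ε) (Or.inr hε)
  obtain ⟨W, hWN, hWo, hxW⟩ := mem_nhds_iff.1
    (inter_mem hN (hΦ'.preimage_mem_nhds (Metric.closedBall_mem_nhds (Φ' x) hε)))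
  refine ⟨W, hWo, hxW, fun y hy z hz => norm_le_mul_of_norm_sub_le hK.le (scale ?_),
    fun y hy v => norm_le_mul_of_norm_sub_le hK.le (scale ?_)⟩
  · exact hlin y (hWN hy).1 z (hWN hz).1
  · exact (Φ' y - Φ' x).le_of_opNorm_le (by simpa [dist_eq_norm] using (hWN hy).2) v

theorem continuous_normDet [CompleteSpace V] :
    Continuous fun A : E →L[ℝ] V => A.toLinearMap.normDet := by
  have hsqrt : (fun A : E →L[ℝ] V => A.toLinearMap.normDet) =
      fun A => √(ContinuousLinearMap.adjoint A ∘L A).det := by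
    ext A
    rw [← Real.sqrt_sq A.toLinearMap.normDet_nonneg]
    congr 1
    exact_mod_cast A.normDet_sq
  rw [hsqrt]
  refine Real.continuous_sqrt.comp (ContinuousLinearMap.continuous_det.comp ?_)
  fun_prop

variable [MeasurableSpace E] [BorelSpace E] [MeasurableSpace V] [BorelSpace V]

theorem normDet_le_of_norm_le {A B : E →L[ℝ] V} {K : NNReal} (h : ∀ v, ‖B v‖ ≤ K * ‖A v‖) :
    ENNReal.ofReal B.toLinearMap.normDet ≤
      (K : ℝ≥0∞) ^ finrank ℝ E * ENNReal.ofReal A.toLinearMap.normDet := by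
  have hball : volume (Metric.ball (0 : E) 1) ≠ 0 := (Metric.measure_ball_pos _ _ one_pos).ne'
  have := euclideanHausdorffMeasure_image_le_of_dist_le (Φ := B.toLinearMap) (Ψ := A.toLinearMap)
    (s := Metric.ball 0 1) (finrank ℝ E)
    fun x _ y _ => by simpa [dist_eq_norm] using h (x - y)
  rw [LinearMap.euclideanHausdorffMeasure_image_eq_normDet_mul_volume,
    LinearMap.euclideanHausdorffMeasure_image_eq_normDet_mul_volume, ← mul_assoc] at this
  exact (ENNReal.mul_le_mul_iff_left hball measure_ball_lt_top.ne).1 this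

theorem exists_isOpen_image_measure_comparable {Φ : E → V} {Φ' : E → E →L[ℝ] V} {x : E}
    (hΦ : ∀ᶠ y in 𝓝 x, HasFDerivAt Φ (Φ' y) y) (hΦ' : ContinuousAt Φ' x)
    (hinj : Function.Injective (Φ' x)) {c : ℝ≥0∞} (hc : 1 < c) :
    ∃ W, IsOpen W ∧ x ∈ W ∧ ∀ s ⊆ W, MeasurableSet s →
      μHE[finrank ℝ E] (Φ '' s) ≤
          c * ∫⁻ y in s, ENNReal.ofReal (Φ' y).toLinearMap.normDet ∧
        ∫⁻ y in s, ENNReal.ofReal (Φ' y).toLinearMap.normDet ≤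
          c * μHE[finrank ℝ E] (Φ '' s) := by
  set d := finrank ℝ E
  obtain ⟨K, hK, hKc⟩ := exists_one_lt_pow_le hc (d + d)
  rw [pow_add] at hKc
  obtain ⟨W, hWo, hxW, hΦW, hΦ'W⟩ :=
    exists_isOpen_comparable_of_continuousAt hΦ hΦ' hinj (K := K) (by exact_mod_cast hK)
  refine ⟨W, hWo, hxW, fun s hsW hs => ?_⟩
  have hKtop : (K : ℝ≥0∞) ^ d ≠ ∞ := by finiteness
  have linear : μHE[d] (Φ' x '' s) = ∫⁻ _ in s, ENNReal.ofReal (Φ' x).toLinearMap.normDet := by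
    rw [setLIntegral_const]
    exact (Φ' x).toLinearMap.euclideanHausdorffMeasure_image_eq_normDet_mul_volume s
  constructor
  · calc μHE[d] (Φ '' s) ≤ K ^ d * μHE[d] (Φ' x '' s) :=
          euclideanHausdorffMeasure_image_le_of_dist_le d fun y hy z hz => by
            rw [dist_eq_norm, dist_eq_norm, ← map_sub]
            exact (hΦW y (hsW hy) z (hsW hz)).1
      _ ≤ K ^ d * ∫⁻ y in s, K ^ d * ENNReal.ofReal (Φ' y).toLinearMap.normDet := by
          rw [linear]
          refine mul_le_mul' le_rfl ?_
          exact setLIntegral_mono' hs fun y hy =>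
            normDet_le_of_norm_le fun v => (hΦ'W y (hsW hy) v).2
      _ ≤ c * ∫⁻ y in s, ENNReal.ofReal (Φ' y).toLinearMap.normDet := by
          rw [lintegral_const_mul' _ _ hKtop, ← mul_assoc]
          gcongr
  · calc ∫⁻ y in s, ENNReal.ofReal (Φ' y).toLinearMap.normDet
        ≤ ∫⁻ _ in s, K ^ d * ENNReal.ofReal (Φ' x).toLinearMap.normDet :=
          setLIntegral_mono' hs fun y hy =>
            normDet_le_of_norm_le fun v => (hΦ'W y (hsW hy) v).1
      _ ≤ K ^ d * (K ^ d * μHE[d] (Φ '' s)) := by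
          rw [lintegral_const_mul' _ _ hKtop, ← linear]
          gcongr
          exact euclideanHausdorffMeasure_image_le_of_dist_le d fun y hy z hz => by
            rw [dist_eq_norm, dist_eq_norm, ← map_sub]
            exact (hΦW y (hsW hy) z (hsW hz)).2
      _ ≤ c * μHE[d] (Φ '' s) := by
          rw [← mul_assoc]
          gcongr

variable {U : Set E} {Φ : E → V} {Φ' : E → E →L[ℝ] V}

theorem comap_euclideanHausdorffMeasure_eq_comap_withDensity (hU : IsOpen U)
    (hΦ : ∀ x ∈ U, HasFDerivAt Φ (Φ' x) x) (hΦ' : ContinuousOn Φ' U)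
    (hinj : ∀ x ∈ U, Function.Injective (Φ' x)) (hΦinj : Set.InjOn Φ U) :
    (μHE[finrank ℝ E] : Measure V).comap (U.domRestrict Φ) =
      (volume.withDensity fun x => ENNReal.ofReal (Φ' x).toLinearMap.normDet).comap
        (Subtype.val : U → E) := by
  have emb : MeasurableEmbedding (U.domRestrict Φ) := ContinuousOn.measurableEmbedding
    hU.measurableSet (fun x hx => (hΦ x hx).continuousAt.continuousWithinAt) hΦinj
  have embU := MeasurableEmbedding.subtype_coe hU.measurableSet
  set μ := (μHE[finrank ℝ E] : Measure V).comap (U.domRestrict Φ)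
  set ν := (volume.withDensity fun x => ENNReal.ofReal (Φ' x).toLinearMap.normDet).comap
    (Subtype.val : U → E)
  have hμ : ∀ s, μ s = μHE[finrank ℝ E] (Φ '' (Subtype.val '' s)) := fun s => by
    rw [emb.comap_apply, Set.image_image]
    rfl
  have hν : ∀ s, MeasurableSet s →
      ν s = ∫⁻ y in Subtype.val '' s, ENNReal.ofReal (Φ' y).toLinearMap.normDet := fun s hs => by
    rw [embU.comap_apply, withDensity_apply _ (embU.measurableSet_image.2 hs)]
  have comparable : ∀ c : ℝ≥0∞, 1 < c → ∀ x : U, ∃ W : Set U, IsOpen W ∧ x ∈ W ∧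
      ∀ s ⊆ W, MeasurableSet s → μ s ≤ c * ν s ∧ ν s ≤ c * μ s := fun c hc x => by
    obtain ⟨W, hWo, hxW, hW⟩ := exists_isOpen_image_measure_comparable
      (mem_of_superset (hU.mem_nhds x.2) hΦ) (hΦ'.continuousAt (hU.mem_nhds x.2))
      (hinj x x.2) hc
    refine ⟨Subtype.val ⁻¹' W, hWo.preimage continuous_subtype_val, hxW, fun s hs hsm => ?_⟩
    rw [hμ, hν s hsm]
    exact hW (Subtype.val '' s) (Set.image_subset_iff.2 hs) (embU.measurableSet_image.2 hsm)
  refine le_antisymm (measure_le_of_locally_le_mul fun c hc x => ?_)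
    (measure_le_of_locally_le_mul fun c hc x => ?_)
  · obtain ⟨W, hWo, hxW, hW⟩ := comparable c hc x
    exact ⟨W, hWo, hxW, fun s hs hsm => (hW s hs hsm).1⟩
  · obtain ⟨W, hWo, hxW, hW⟩ := comparable c hc x
    exact ⟨W, hWo, hxW, fun s hs hsm => (hW s hs hsm).2⟩

theorem integral_image_eq_integral_normDet_fderiv_smul [CompleteSpace V] {F : Type*}
    [NormedAddCommGroup F] [NormedSpace ℝ F] (hU : IsOpen U) (hΦ : ∀ x ∈ U, HasFDerivAt Φ (Φ' x) x)
    (hΦ' : ContinuousOn Φ' U) (hinj : ∀ x ∈ U, Function.Injective (Φ' x))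
    (hΦinj : Set.InjOn Φ U) (g : V → F) :
    ∫ y in Φ '' U, g y ∂μHE[finrank ℝ E] =
      ∫ x in U, (Φ' x).toLinearMap.normDet • g (Φ x) := by
  have emb : MeasurableEmbedding (U.domRestrict Φ) := ContinuousOn.measurableEmbedding
    hU.measurableSet (fun x hx => (hΦ x hx).continuousAt.continuousWithinAt) hΦinj
  have hJ : AEMeasurable (fun x => (Φ' x).toLinearMap.normDet) (volume.restrict U) :=
    (continuous_normDet.comp_continuousOn hΦ').aemeasurable hU.measurableSet
  rw [← Set.range_domRestrict, ← emb.map_comap, emb.integral_map,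
    comap_euclideanHausdorffMeasure_eq_comap_withDensity hU hΦ hΦ' hinj hΦinj]
  simp only [Set.domRestrict_apply]
  rw [integral_subtype_comap hU.measurableSet (fun x => g (Φ x)),
    setIntegral_withDensity_eq_setIntegral_toReal_smul₀ hJ.ennreal_ofReal (by simp) _
      hU.measurableSet]
  simp only [ENNReal.toReal_ofReal (LinearMap.normDet_nonneg _)]

end AreaFormula

/-! ### Oscillatory integrals with a convex phase -/

section RadialDerivative

open Module Measure

variable {E F : Type*} [NormedAddCommGroup E] [NormedSpace ℝ E]
  [NormedAddCommGroup F] [NormedSpace ℝ F]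

/-- The derivative of `h` along the radial vector field `x ↦ x - x₀`. -/
noncomputable def radialDeriv (h : E → F) (x₀ x : E) : F := fderiv ℝ h x (x - x₀)

/-- The divergence of the vector field `x ↦ h x • (x - x₀)`. -/
noncomputable def radialDiv (h : E → F) (x₀ x : E) : F :=
  radialDeriv h x₀ x + (finrank ℝ E : ℝ) • h x

theorem contDiffAt_radialDeriv {h : E → F} {x₀ x : E} (hh : ContDiffAt ℝ 2 h x) :
    ContDiffAt ℝ 1 (radialDeriv h x₀) x :=
  (hh.fderiv_right (m := 1) (by norm_num)).clm_apply (contDiffAt_id.sub contDiffAt_const)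

theorem continuous_uncurry_radialDiv {h : E → F} (hh : ContDiff ℝ 1 h) :
    Continuous fun p : E × E => radialDiv h p.1 p.2 := by
  have := hh.continuous_fderiv one_ne_zero
  have := hh.continuous
  unfold radialDiv radialDeriv
  fun_prop

theorem radialDiv_eq_zero_of_notMem_tsupport {h : E → F} {x₀ x : E} (hx : x ∉ tsupport h) :
    radialDiv h x₀ x = 0 := by
  simp [radialDiv, radialDeriv, fderiv_of_notMem_tsupport ℝ hx,
    image_eq_zero_of_notMem_tsupport hx]

theorem tsupport_radialDiv_subset (h : E → F) (x₀ : E) : tsupport (radialDiv h x₀) ⊆ tsupport h :=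
  closure_minimal (fun _ hx => by_contra fun hx' => hx (radialDiv_eq_zero_of_notMem_tsupport hx'))
    (isClosed_tsupport h)

theorem continuous_smul_of_continuousAt_tsupport {X : Type*} [TopologicalSpace X] {η : X → ℝ}
    {w : X → F} (hη : Continuous η) (hw : ∀ x ∈ tsupport η, ContinuousAt w x) :
    Continuous fun x => η x • w x :=
  continuous_of_tsupport fun x hx =>
    hη.continuousAt.smul (hw x (tsupport_smul_subset_left η w hx))

theorem integrable_smul_of_continuousAt_tsupport {X : Type*} [TopologicalSpace X]
    [MeasurableSpace X] [OpensMeasurableSpace X] (μ : Measure X) [IsFiniteMeasureOnCompacts μ]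
    {η : X → ℝ} {w : X → F} (hη : Continuous η) (hc : HasCompactSupport η)
    (hw : ∀ x ∈ tsupport η, ContinuousAt w x) : Integrable (fun x => η x • w x) μ :=
  (continuous_smul_of_continuousAt_tsupport hη hw).integrable_of_hasCompactSupport hc.smul_right

theorem sum_repr_smul_apply {ι : Type*} [Fintype ι] (b : Basis ι ℝ E) (l : E →L[ℝ] F) (v : E) :
    ∑ i, b.repr v i • l (b i) = l v := by
  rw [← congrArg l (b.sum_repr v), _root_.map_sum]
  simp only [map_smul]

theorem contDiff_of_contDiffAt_tsupport {m : WithTop ℕ∞} {f : E → F}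
    (h : ∀ x ∈ tsupport f, ContDiffAt ℝ m f x) : ContDiff ℝ m f := by
  refine contDiff_iff_contDiffAt.mpr fun x => ?_
  by_cases hx : x ∈ tsupport f
  · exact h x hx
  · exact contDiffAt_const.congr_of_eventuallyEq (notMem_tsupport_iff_eventuallyEq.mp hx)

section Integrable

variable [MeasurableSpace E] [OpensMeasurableSpace E] (μ : Measure E)
  [IsFiniteMeasureOnCompacts μ] {η : E → ℝ} {w : E → F}

theorem integrable_fderiv_apply_smul (hη : ContDiff ℝ 1 η) (hc : HasCompactSupport η)
    (hw : ∀ x ∈ tsupport η, ContinuousAt w x) (v : E) :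
    Integrable (fun x => fderiv ℝ η x v • w x) μ :=
  integrable_smul_of_continuousAt_tsupport μ
    ((hη.continuous_fderiv one_ne_zero).clm_apply continuous_const) (hc.fderiv_apply (𝕜 := ℝ) v)
    fun x hx => hw x (tsupport_fderiv_apply_subset ℝ v hx)

theorem integrable_smul_fderiv_apply (hη : Continuous η) (hc : HasCompactSupport η)
    (hw : ∀ x ∈ tsupport η, ContDiffAt ℝ 1 w x) {v : E → E} (hv : Continuous v) :
    Integrable (fun x => η x • fderiv ℝ w x (v x)) μ :=
  integrable_smul_of_continuousAt_tsupport μ hη hc fun x hx =>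
    ((hw x hx).fderiv_right (m := 0) (by norm_num)).continuousAt.clm_apply hv.continuousAt

theorem integrable_radialDiv_smul (hη : ContDiff ℝ 1 η) (hc : HasCompactSupport η) (x₀ : E)
    (hw : ∀ x ∈ tsupport η, ContinuousAt w x) : Integrable (fun x => radialDiv η x₀ x • w x) μ :=
  integrable_smul_of_continuousAt_tsupport μ
    ((continuous_uncurry_radialDiv hη).comp (Continuous.prodMk_right x₀))
    (hc.of_isClosed_subset (isClosed_tsupport _) (tsupport_radialDiv_subset η x₀))
    fun x hx => hw x (tsupport_radialDiv_subset η x₀ hx)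

end Integrable

variable [FiniteDimensional ℝ E] [MeasurableSpace E] [BorelSpace E] (μ : Measure E)
  [IsAddHaarMeasure μ]

theorem integral_smul_radialDeriv_eq_neg {η : E → ℝ} {w : E → F} (hη : ContDiff ℝ 1 η)
    (hc : HasCompactSupport η) (hw : ∀ x ∈ tsupport η, ContDiffAt ℝ 1 w x) (x₀ : E) :
    ∫ x, η x • radialDeriv w x₀ x ∂μ = -∫ x, radialDiv η x₀ x • w x ∂μ := by
  let b := finBasis ℝ E
  let coord : Fin (finrank ℝ E) → E →L[ℝ] ℝ := fun i => (b.coord i).toContinuousLinearMap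
  have hcoord : ∀ i v, coord i v = b.repr v i := fun _ _ => rfl
  let f : Fin (finrank ℝ E) → E → ℝ := fun i x => η x * coord i (x - x₀)
  have hf : ∀ i, ContDiff ℝ 1 (f i) := fun i => by fun_prop
  have hf' : ∀ i x, fderiv ℝ (f i) x (b i) = coord i (x - x₀) * fderiv ℝ η x (b i) + η x := by
    intro i x
    have : HasFDerivAt (f i) _ x := (hη.differentiable one_ne_zero x).hasFDerivAt.mul
      ((coord i).hasFDerivAt.comp x ((hasFDerivAt_id x).sub_const x₀))
    rw [this.fderiv]
    simp [coord, add_comm]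
  have hfc : ∀ i, HasCompactSupport (f i) := fun i => hc.mul_right
  have hfw : ∀ i, ∀ x ∈ tsupport (f i), ContDiffAt ℝ 1 w x := fun i x hx =>
    hw x (tsupport_mul_subset_left hx)
  have int₁ : ∀ i, Integrable (fun x => fderiv ℝ (f i) x (b i) • w x) μ := fun i =>
    integrable_fderiv_apply_smul μ (hf i) (hfc i) (fun x hx => (hfw i x hx).continuousAt) (b i)
  have int₂ : ∀ i, Integrable (fun x => f i x • fderiv ℝ w x (b i)) μ := fun i =>
    integrable_smul_fderiv_apply μ (hf i).continuous (hfc i) (hfw i) continuous_const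
  have by_parts : ∀ i, ∫ x, f i x • fderiv ℝ w x (b i) ∂μ =
      -∫ x, fderiv ℝ (f i) x (b i) • w x ∂μ := fun i =>
    integral_smul_fderiv_eq_neg_fderiv_smul_of_integrable (int₁ i) (int₂ i)
      (integrable_smul_of_continuousAt_tsupport μ (hf i).continuous (hfc i)
        fun x hx => (hfw i x hx).continuousAt)
      (fun x _ => (hf i).differentiable one_ne_zero x)
      (fun x hx => (hfw i x hx).differentiableAt one_ne_zero)
  calc ∫ x, η x • radialDeriv w x₀ x ∂μ = ∫ x, ∑ i, f i x • fderiv ℝ w x (b i) ∂μ := by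
        simp only [f, mul_smul, ← Finset.smul_sum, hcoord, sum_repr_smul_apply, radialDeriv]
    _ = -∫ x, ∑ i, fderiv ℝ (f i) x (b i) • w x ∂μ := by
        rw [integral_finsetSum _ fun i _ => int₂ i, integral_finsetSum _ fun i _ => int₁ i,
          ← Finset.sum_neg_distrib]
        exact Finset.sum_congr rfl fun i _ => by_parts i
    _ = -∫ x, radialDiv η x₀ x • w x ∂μ := by
        simp only [← Finset.sum_smul, hf', Finset.sum_add_distrib, ← smul_eq_mul, hcoord,
          sum_repr_smul_apply]
        simp [radialDiv, radialDeriv]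

end RadialDerivative

section ConvexPhase

variable {E : Type*} [NormedAddCommGroup E] [NormedSpace ℝ E] {U : Set E} {g : E → ℝ} {x₀ x : E}

theorem add_fderiv_le_of_convexOn (hg : ConvexOn ℝ U g) (hd : DifferentiableAt ℝ g x) (hx : x ∈ U)
    {y : E} (hy : y ∈ U) : g x + fderiv ℝ g x (y - x) ≤ g y := by
  have hline : HasDerivAt (g ∘ AffineMap.lineMap x y) (fderiv ℝ g x (y - x)) (0 : ℝ) := by
    have h0 : HasFDerivAt g (fderiv ℝ g x) (AffineMap.lineMap x y (0 : ℝ)) := by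
      simpa using hd.hasFDerivAt
    exact h0.comp_hasDerivAt 0 AffineMap.hasDerivAt_lineMap
  have := (hg.comp_affineMap (AffineMap.lineMap x y)).le_slope_of_hasDerivAt
    (x := 0) (y := 1) (by simpa using hx) (by simpa using hy) one_pos hline
  simp only [slope_def_field, Function.comp_apply, AffineMap.lineMap_apply_one,
    AffineMap.lineMap_apply_zero, sub_zero, div_one] at this
  linarith

theorem fderiv_fderiv_apply_self_nonneg_of_convexOn (hU : IsOpen U) (hg : ContDiffOn ℝ 2 g U)
    (hconv : ConvexOn ℝ U g) (hx : x ∈ U) (v : E) : 0 ≤ fderiv ℝ (fderiv ℝ g) x v v := by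
  have hd : ∀ y ∈ U, DifferentiableAt ℝ g y := fun y hy =>
    (hg.contDiffAt (hU.mem_nhds hy)).differentiableAt two_ne_zero
  have hline : HasDerivAt (fun s : ℝ => x + s • v) v 0 := by
    simpa using ((hasDerivAt_id (0 : ℝ)).smul_const v).const_add x
  have hderiv : HasDerivAt (fun s : ℝ => fderiv ℝ g (x + s • v) v)
      (fderiv ℝ (fderiv ℝ g) x v v) 0 := by
    have hx0 : x + (0 : ℝ) • v = x := by simp
    have h1 : HasFDerivAt (fderiv ℝ g) (fderiv ℝ (fderiv ℝ g) x) (x + (0 : ℝ) • v) := by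
      rw [hx0]
      exact (((hg.contDiffAt (hU.mem_nhds hx)).fderiv_right (m := 1)
        (by norm_num)).differentiableAt one_ne_zero).hasFDerivAt
    have h2 := h1.comp_hasDerivAt (0 : ℝ) hline
    simpa using h2.clm_apply (hasDerivAt_const (0 : ℝ) v)
  have hnear : ∀ᶠ s : ℝ in 𝓝[≠] 0, x + s • v ∈ U :=
    nhdsWithin_le_nhds (hline.continuousAt.eventually_mem (by simpa using hU.mem_nhds hx))
  refine ge_of_tendsto (hasDerivAt_iff_tendsto_slope.mp hderiv) ?_
  filter_upwards [hnear, self_mem_nhdsWithin] with s hs hs0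
  -- Adding the tangent inequalities at `x` and at `x + s • v` shows that the derivative increases.
  have h1 := add_fderiv_le_of_convexOn hconv (hd x hx) hx hs
  have h2 := add_fderiv_le_of_convexOn hconv (hd _ hs) hs hx
  rw [add_sub_cancel_left, map_smul, smul_eq_mul] at h1
  rw [sub_add_cancel_left, map_neg, map_smul, smul_eq_mul] at h2
  rw [slope_def_field, zero_smul, add_zero, sub_zero, ← mul_div_mul_left _ _ (show s ≠ 0 from hs0)]
  exact div_nonneg (by linarith) (mul_self_nonneg s)

theorem sub_le_radialDeriv_of_convexOn (hg : ConvexOn ℝ U g) (hd : DifferentiableAt ℝ g x)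
    (hx : x ∈ U) (hx₀ : x₀ ∈ U) : g x - g x₀ ≤ radialDeriv g x₀ x := by
  have := add_fderiv_le_of_convexOn hg hd hx hx₀
  rw [← neg_sub x x₀, map_neg] at this
  unfold radialDeriv
  linarith

theorem radialDeriv_radialDeriv_nonneg (hU : IsOpen U) (hg : ContDiffOn ℝ 2 g U)
    (hconv : ConvexOn ℝ U g) (hx : x ∈ U) (hx₀ : 0 ≤ radialDeriv g x₀ x) :
    0 ≤ radialDeriv (radialDeriv g x₀) x₀ x := by
  have h1 : HasFDerivAt (radialDeriv g x₀) _ x :=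
    (((hg.contDiffAt (hU.mem_nhds hx)).fderiv_right (m := 1) (by norm_num)).differentiableAt
      one_ne_zero).hasFDerivAt.clm_apply ((hasFDerivAt_id x).sub_const x₀)
  rw [radialDeriv, h1.fderiv]
  exact add_nonneg hx₀ (fderiv_fderiv_apply_self_nonneg_of_convexOn hU hg hconv hx (x - x₀))

/-- The factor `(1 + ∂g)⁻¹`, with `∂` the radial derivative from the minimum `x₀` of the phase `g`.
Multiplying the amplitude by it before integrating by parts along the radial field trades
oscillation of `exp (i g)` for decay in `g`. -/
noncomputable def radialDamping (g : E → ℝ) (x₀ x : E) : ℝ := (1 + radialDeriv g x₀ x)⁻¹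

theorem radialDamping_pos (hx : 0 ≤ radialDeriv g x₀ x) : 0 < radialDamping g x₀ x := by
  unfold radialDamping
  positivity

theorem contDiffAt_radialDamping (hg : ContDiffAt ℝ 2 g x) (hx : 0 ≤ radialDeriv g x₀ x) :
    ContDiffAt ℝ 1 (radialDamping g x₀) x :=
  (contDiffAt_const.add (contDiffAt_radialDeriv hg)).inv (by positivity)

theorem radialDeriv_radialDamping_nonpos (hU : IsOpen U) (hg : ContDiffOn ℝ 2 g U)
    (hconv : ConvexOn ℝ U g) (hx : x ∈ U) (hx₀ : 0 ≤ radialDeriv g x₀ x) :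
    radialDeriv (radialDamping g x₀) x₀ x ≤ 0 := by
  have hne : 1 + radialDeriv g x₀ x ≠ 0 := by positivity
  have h1 : HasFDerivAt (radialDamping g x₀) _ x := (hasDerivAt_inv hne).comp_hasFDerivAt x
    (((contDiffAt_radialDeriv (hg.contDiffAt (hU.mem_nhds hx))).differentiableAt
      one_ne_zero).hasFDerivAt.const_add 1)
  have h2 := radialDeriv_radialDeriv_nonneg hU hg hconv hx hx₀
  rw [radialDeriv, h1.fderiv]
  have h3 : 0 ≤ ((1 + radialDeriv g x₀ x) ^ 2)⁻¹ := by positivity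
  simpa [radialDeriv, -map_sub] using mul_nonneg h3 h2

theorem radialDeriv_cexp_mul_radialDamping (hg : ContDiffAt ℝ 2 g x)
    (hx : 0 ≤ radialDeriv g x₀ x) :
    radialDeriv (fun y => Complex.exp (Complex.I * g y) * radialDamping g x₀ y) x₀ x =
      Complex.exp (Complex.I * g x) * (Complex.I * (1 - radialDamping g x₀ x) +
        radialDeriv (radialDamping g x₀) x₀ x) := by
  have h_exp : HasFDerivAt (fun y => Complex.exp (Complex.I * g y)) _ x :=
    ((Complex.ofRealCLM.hasFDerivAt.comp x
      (hg.differentiableAt two_ne_zero).hasFDerivAt).const_mul Complex.I).cexp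
  have h_damping : HasFDerivAt (fun y => (radialDamping g x₀ y : ℂ)) _ x :=
    Complex.ofRealCLM.hasFDerivAt.comp x
      ((contDiffAt_radialDamping hg hx).differentiableAt one_ne_zero).hasFDerivAt
  have h_cancel : (fderiv ℝ g x (x - x₀) : ℂ) * radialDamping g x₀ x =
      1 - radialDamping g x₀ x := by
    have hne : 1 + radialDeriv g x₀ x ≠ 0 := by positivity
    have : radialDeriv g x₀ x * radialDamping g x₀ x = 1 - radialDamping g x₀ x := by
      unfold radialDamping
      field_simp
      ring
    exact_mod_cast this
  have h_mul : HasFDerivAt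
      (fun y => Complex.exp (Complex.I * g y) * (radialDamping g x₀ y : ℂ)) _ x :=
    h_exp.mul h_damping
  rw [radialDeriv, h_mul.fderiv, ← h_cancel]
  simp [radialDeriv]
  ring

end ConvexPhase

section DampingEstimate

variable {E : Type*} [NormedAddCommGroup E] [NormedSpace ℝ E] [FiniteDimensional ℝ E]
  [MeasurableSpace E] [BorelSpace E] (μ : Measure E) [μ.IsAddHaarMeasure]
  {U K : Set E} {g η χ : E → ℝ} {x₀ : E}

theorem integral_smul_cexp_eq_integral_cexp_mul_radialDamping
    (hg : ∀ x ∈ tsupport η, ContDiffAt ℝ 2 g x) (hD : ∀ x ∈ tsupport η, 0 ≤ radialDeriv g x₀ x)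
    (hη : ContDiff ℝ 1 η) (hc : HasCompactSupport η) :
    ∫ x, η x • Complex.exp (Complex.I * g x) ∂μ =
      ∫ x, Complex.exp (Complex.I * g x) *
        (η x * (radialDamping g x₀ x + Complex.I * radialDeriv (radialDamping g x₀) x₀ x) +
          Complex.I * (radialDiv η x₀ x * radialDamping g x₀ x)) ∂μ := by
  set w : E → ℂ := fun x => Complex.exp (Complex.I * g x) * radialDamping g x₀ x
  have hw : ∀ x ∈ tsupport η, ContDiffAt ℝ 1 w x := fun x hx =>
    ((contDiffAt_const.mul (Complex.ofRealCLM.contDiff.contDiffAt.comp x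
      ((hg x hx).of_le one_le_two))).cexp).mul
      (Complex.ofRealCLM.contDiff.contDiffAt.comp x (contDiffAt_radialDamping (hg x hx) (hD x hx)))
  have int₁ : Integrable (fun x => η x • Complex.exp (Complex.I * g x)) μ :=
    integrable_smul_of_continuousAt_tsupport μ hη.continuous hc fun x hx =>
      (continuousAt_const.mul (Complex.continuous_ofReal.continuousAt.comp
        (hg x hx).continuousAt)).cexp
  have int₂ : Integrable (fun x => η x • radialDeriv w x₀ x) μ :=
    integrable_smul_fderiv_apply μ hη.continuous hc hw (continuous_sub_right x₀)
  have int₃ : Integrable (fun x => radialDiv η x₀ x • w x) μ :=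
    integrable_radialDiv_smul μ hη hc x₀ fun x hx => (hw x hx).continuousAt
  calc ∫ x, η x • Complex.exp (Complex.I * g x) ∂μ
      = ∫ x, η x • Complex.exp (Complex.I * g x) ∂μ + Complex.I *
          (∫ x, η x • radialDeriv w x₀ x ∂μ + ∫ x, radialDiv η x₀ x • w x ∂μ) := by
        rw [integral_smul_radialDeriv_eq_neg μ hη hc hw, neg_add_cancel, mul_zero, add_zero]
    _ = ∫ x, (η x • Complex.exp (Complex.I * g x) + Complex.I *
          (η x • radialDeriv w x₀ x + radialDiv η x₀ x • w x)) ∂μ := by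
        rw [← integral_add int₂ int₃, ← integral_const_mul, ← integral_add int₁]
        exact (int₂.add int₃).const_mul _
    _ = _ := by
        congr with x
        by_cases hx : x ∈ tsupport η
        · rw [radialDeriv_cexp_mul_radialDamping (hg x hx) (hD x hx)]
          simp only [Complex.real_smul, w]
          linear_combination Complex.exp (Complex.I * g x) * η x *
            (1 - radialDamping g x₀ x) * Complex.I_sq
        · simp [image_eq_zero_of_notMem_tsupport hx, radialDiv_eq_zero_of_notMem_tsupport hx]

theorem norm_exp_mul_damped_amplitude_le {θ a c d q q' : ℝ} (hq : 0 ≤ q) (hq' : q' ≤ 0)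
    (hac : |a| ≤ c) : ‖Complex.exp (Complex.I * θ) * (a * (q + Complex.I * q') +
      Complex.I * (d * q))‖ ≤ (|a| + |d|) * q - c * q' := by
  have norm_q : ‖(q + Complex.I * q' : ℂ)‖ ≤ q - q' := by
    simpa [abs_of_nonneg hq, abs_of_nonpos hq', ← sub_eq_add_neg] using
      norm_add_le (q : ℂ) (Complex.I * q')
  calc ‖Complex.exp (Complex.I * θ) * (a * (q + Complex.I * q') + Complex.I * (d * q))‖
      ≤ ‖(a * (q + Complex.I * q') : ℂ)‖ + ‖(Complex.I * (d * q) : ℂ)‖ := by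
        rw [norm_mul, mul_comm Complex.I (θ : ℂ), Complex.norm_exp_ofReal_mul_I, one_mul]
        exact norm_add_le _ _
    _ = |a| * ‖(q + Complex.I * q' : ℂ)‖ + |d| * q := by
        simp [abs_of_nonneg hq]
    _ ≤ |a| * (q - q') + |d| * q := by gcongr
    _ ≤ (|a| + |d|) * q - c * q' := by linarith [mul_le_mul_of_nonneg_right hac (neg_nonneg.2 hq')]

theorem norm_integral_smul_cexp_le_integral_radialDamping (hU : IsOpen U) (hg : ContDiffOn ℝ 2 g U)
    (hconv : ConvexOn ℝ U g) (hK : IsCompact K) (hKU : K ⊆ U)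
    (hD : ∀ x ∈ K, 0 ≤ radialDeriv g x₀ x)
    (hη : ContDiff ℝ 1 η) (hηK : tsupport η ⊆ K) (hχ : ContDiff ℝ 1 χ) (hχK : tsupport χ ⊆ K)
    (hηχ : ∀ x, |η x| ≤ χ x) :
    ‖∫ x, η x • Complex.exp (Complex.I * g x) ∂μ‖ ≤
      ∫ x in K, (|η x| + |radialDiv η x₀ x| + radialDiv χ x₀ x) * radialDamping g x₀ x ∂μ := by
  set q := radialDamping g x₀
  have hg' : ∀ x ∈ K, ContDiffAt ℝ 2 g x := fun x hx => hg.contDiffAt (hU.mem_nhds (hKU hx))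
  have hq : ∀ x ∈ K, ContDiffAt ℝ 1 q x := fun x hx =>
    contDiffAt_radialDamping (hg' x hx) (hD x hx)
  have hq_cont : ContinuousOn q K := fun x hx => (hq x hx).continuousAt.continuousWithinAt
  have hηc := hK.of_isClosed_subset (isClosed_tsupport η) hηK
  have hχc := hK.of_isClosed_subset (isClosed_tsupport χ) hχK
  have cont_div : ∀ {f : E → ℝ}, ContDiff ℝ 1 f → Continuous (radialDiv f x₀) := fun hf =>
    (continuous_uncurry_radialDiv hf).comp (Continuous.prodMk_right x₀)
  have int_η : IntegrableOn (fun x => (|η x| + |radialDiv η x₀ x|) * q x) K μ :=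
    (((hη.continuous.abs.add (cont_div hη).abs).continuousOn.mul hq_cont)).integrableOn_compact hK
  have int_χ : IntegrableOn (fun x => radialDiv χ x₀ x * q x) K μ :=
    ((cont_div hχ).continuousOn.mul hq_cont).integrableOn_compact hK
  have int_q : IntegrableOn (fun x => χ x • radialDeriv q x₀ x) K μ :=
    (integrable_smul_fderiv_apply μ hχ.continuous hχc (fun x hx => hq x (hχK hx))
      (continuous_sub_right x₀)).integrableOn
  have by_parts : ∫ x in K, χ x • radialDeriv q x₀ x ∂μ = -∫ x in K, radialDiv χ x₀ x * q x ∂μ := by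
    rw [setIntegral_eq_integral_of_forall_compl_eq_zero fun x hx => by
        rw [image_eq_zero_of_notMem_tsupport fun h => hx (hχK h), zero_smul],
      setIntegral_eq_integral_of_forall_compl_eq_zero fun x hx => by
        rw [radialDiv_eq_zero_of_notMem_tsupport fun h => hx (hχK h), zero_mul]]
    exact integral_smul_radialDeriv_eq_neg μ hχ hχc (fun x hx => hq x (hχK hx)) x₀
  rw [integral_smul_cexp_eq_integral_cexp_mul_radialDamping μ (fun x hx => hg' x (hηK hx))
      (fun x hx => hD x (hηK hx)) hη hηc,
    ← setIntegral_eq_integral_of_forall_compl_eq_zero (s := K) fun x hx => by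
      have : x ∉ tsupport η := fun h => hx (hηK h)
      simp [image_eq_zero_of_notMem_tsupport this, radialDiv_eq_zero_of_notMem_tsupport this]]
  refine (norm_integral_le_of_norm_le (int_η.sub int_q)
    ((ae_restrict_iff' hK.measurableSet).2 (ae_of_all _ fun x hx =>
      norm_exp_mul_damped_amplitude_le (radialDamping_pos (hD x hx)).le
        (radialDeriv_radialDamping_nonpos hU hg hconv (hKU hx) (hD x hx)) (hηχ x)))).trans_eq ?_
  simp only [add_mul _ (radialDiv χ x₀ _)]
  rw [integral_sub' int_η int_q, integral_add int_η int_χ, by_parts, sub_neg_eq_add]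

end DampingEstimate

section UniformDecay

theorem integral_inv_one_add_le_of_measure_le {X : Type*} [MeasurableSpace X] {μ : Measure X}
    {u : X → ℝ} {C α : ℝ} (hC : 0 ≤ C) (hα : α < 1) (hu : ∀ᵐ x ∂μ, 0 ≤ u x)
    (hμ : ∀ s, 0 < s → μ {x | u x ≤ s} ≤ ENNReal.ofReal (C * s ^ α)) :
    ∫ x, (1 + u x)⁻¹ ∂μ ≤ C / (1 - α) := by
  by_cases hint : Integrable (fun x => (1 + u x)⁻¹) μ
  swap
  · rw [integral_undef hint]
    exact div_nonneg hC (sub_nonneg.2 hα.le)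
  have superlevel : ∀ τ ∈ Set.Ioc (0 : ℝ) 1, μ.real {x | τ ≤ (1 + u x)⁻¹} ≤ C * τ ^ (-α) := by
    refine fun τ hτ => ENNReal.toReal_le_of_le_ofReal
      (mul_nonneg hC (Real.rpow_nonneg hτ.1.le _)) ?_
    rw [Real.rpow_neg hτ.1.le, ← Real.inv_rpow hτ.1.le]
    refine (measure_mono_ae ?_).trans (hμ _ (inv_pos.2 hτ.1))
    filter_upwards [hu] with x hx (hτx : τ ≤ (1 + u x)⁻¹)
    have : 1 + u x ≤ τ⁻¹ := (le_inv_comm₀ hτ.1 (by linarith)).1 hτx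
    change u x ≤ τ⁻¹
    linarith
  have int_rpow : IntegrableOn (fun τ : ℝ => C * τ ^ (-α)) (Set.Ioc 0 1) :=
    ((intervalIntegrable_iff_integrableOn_Ioc_of_le zero_le_one).1
      (intervalIntegral.intervalIntegrable_rpow' (neg_lt_neg hα))).const_mul C
  rw [hint.integral_eq_integral_Ioc_meas_le (M := 1)
    (hu.mono fun x hx => inv_nonneg.2 (add_nonneg zero_le_one hx))
    (hu.mono fun x hx => inv_le_one_of_one_le₀ (le_add_of_nonneg_right hx))]
  calc ∫ τ in Set.Ioc 0 1, μ.real {x | τ ≤ (1 + u x)⁻¹}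
      ≤ ∫ τ in Set.Ioc (0 : ℝ) 1, C * τ ^ (-α) :=
        integral_mono_of_nonneg (ae_of_all _ fun τ => measureReal_nonneg) int_rpow
          ((ae_restrict_iff' measurableSet_Ioc).2 (ae_of_all _ superlevel))
    _ = C / (1 - α) := by
        rw [integral_const_mul, ← intervalIntegral.integral_of_le zero_le_one,
          integral_rpow (Or.inl (neg_lt_neg hα)), Real.one_rpow,
          Real.zero_rpow (by linarith), sub_zero, neg_add_eq_sub, mul_one_div]

variable {E : Type*} [NormedAddCommGroup E] [NormedSpace ℝ E] [FiniteDimensional ℝ E]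
  [MeasurableSpace E] [BorelSpace E] (μ : Measure E) [μ.IsAddHaarMeasure]

theorem norm_integral_smul_cexp_le_integral_inv_one_add {U K : Set E} {g η χ : E → ℝ} {x₀ : E}
    {M : ℝ} (hU : IsOpen U) (hg : ContDiffOn ℝ 2 g U) (hconv : ConvexOn ℝ U g) (hK : IsCompact K)
    (hKU : K ⊆ U) (hx₀ : x₀ ∈ K) (hmin : IsMinOn g K x₀)
    (hη : ContDiff ℝ 1 η) (hηK : tsupport η ⊆ K) (hχ : ContDiff ℝ 1 χ) (hχK : tsupport χ ⊆ K)
    (hηχ : ∀ x, |η x| ≤ χ x) (hM₀ : 0 ≤ M)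
    (hM : ∀ x ∈ K, |η x| + |radialDiv η x₀ x| + radialDiv χ x₀ x ≤ M) :
    ‖∫ x, η x • Complex.exp (Complex.I * g x) ∂μ‖ ≤ M * ∫ x in K, (1 + (g x - g x₀))⁻¹ ∂μ := by
  have hg₀ : ∀ x ∈ K, 0 ≤ g x - g x₀ := fun x hx => sub_nonneg.2 (hmin hx)
  have hgD : ∀ x ∈ K, g x - g x₀ ≤ radialDeriv g x₀ x := fun x hx =>
    sub_le_radialDeriv_of_convexOn hconv
      ((hg.contDiffAt (hU.mem_nhds (hKU hx))).differentiableAt two_ne_zero) (hKU hx) (hKU hx₀)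
  have hD : ∀ x ∈ K, 0 ≤ radialDeriv g x₀ x := fun x hx => (hg₀ x hx).trans (hgD x hx)
  have hcont : ContinuousOn (fun x => (1 + (g x - g x₀))⁻¹) K :=
    (continuousOn_const.add ((hg.continuousOn.mono hKU).sub continuousOn_const)).inv₀
      fun x hx => (add_pos_of_pos_of_nonneg one_pos (hg₀ x hx)).ne'
  have damped : ∀ x ∈ K, (|η x| + |radialDiv η x₀ x| + radialDiv χ x₀ x) * radialDamping g x₀ x ≤
      M * (1 + (g x - g x₀))⁻¹ := fun x hx =>
    mul_le_mul (hM x hx) (inv_anti₀ (by linarith [hg₀ x hx]) (by linarith [hgD x hx]))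
      (radialDamping_pos (hD x hx)).le hM₀
  have cont_div : ∀ {f : E → ℝ}, ContDiff ℝ 1 f → Continuous (radialDiv f x₀) := fun hf =>
    (continuous_uncurry_radialDiv hf).comp (Continuous.prodMk_right x₀)
  have cont_damping : ContinuousOn (radialDamping g x₀) K := fun x hx =>
    (contDiffAt_radialDamping (hg.contDiffAt (hU.mem_nhds (hKU hx)))
      (hD x hx)).continuousAt.continuousWithinAt
  rw [← integral_const_mul]
  exact (norm_integral_smul_cexp_le_integral_radialDamping μ hU hg hconv hK hKU hD hη hηK hχ hχK
    hηχ).trans (setIntegral_mono_on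
      (((hη.continuous.abs.add (cont_div hη).abs).add (cont_div hχ)).continuousOn.mul
        cont_damping |>.integrableOn_compact hK)
      ((continuousOn_const.mul hcont).integrableOn_compact hK) hK.measurableSet damped)

theorem exists_forall_norm_integral_smul_cexp_le {η : E → ℝ} (hη : ContDiff ℝ 1 η) {c : E}
    {ρ R : ℝ} (hρ : 0 < ρ) (hρR : ρ < R) (hηρ : tsupport η ⊆ Metric.closedBall c ρ) :
    ∃ M, 0 ≤ M ∧ ∀ (U : Set E) (g : E → ℝ) (x₀ : E), IsOpen U → ContDiffOn ℝ 2 g U →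
      ConvexOn ℝ U g → Metric.closedBall c R ⊆ U → x₀ ∈ Metric.closedBall c R →
      IsMinOn g (Metric.closedBall c R) x₀ → ‖∫ x, η x • Complex.exp (Complex.I * g x) ∂μ‖ ≤
        M * ∫ x in Metric.closedBall c R, (1 + (g x - g x₀))⁻¹ ∂μ := by
  let b : ContDiffBump c := ⟨ρ, R, hρ, hρR⟩
  have hK : IsCompact (Metric.closedBall c R) := isCompact_closedBall c R
  have hηc : HasCompactSupport η :=
    (isCompact_closedBall c ρ).of_isClosed_subset (isClosed_tsupport η) hηρ
  obtain ⟨M₀, hM₀⟩ := hηc.exists_bound_of_continuous hη.continuous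
  set χ : E → ℝ := fun x => M₀ * b x
  have hχ : ContDiff ℝ 1 χ := contDiff_const.mul b.contDiff
  have hηχ : ∀ x, |η x| ≤ χ x := fun x => by
    by_cases hx : x ∈ tsupport η
    · simpa [χ, b.one_of_mem_closedBall (hηρ hx)] using hM₀ x
    · rw [image_eq_zero_of_notMem_tsupport hx, abs_zero]
      exact mul_nonneg ((norm_nonneg _).trans (hM₀ x)) b.nonneg
  obtain ⟨M, hM⟩ := (hK.prod hK).exists_bound_of_continuousOn
    (f := fun p => |η p.2| + |radialDiv η p.1 p.2| + radialDiv χ p.1 p.2)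
    (((hη.continuous.comp continuous_snd).abs.add (continuous_uncurry_radialDiv hη).abs).add
      (continuous_uncurry_radialDiv hχ)).continuousOn
  have hcR : c ∈ Metric.closedBall c R := Metric.mem_closedBall_self (hρ.trans hρR).le
  exact ⟨M, (norm_nonneg _).trans (hM (c, c) ⟨hcR, hcR⟩), fun U g x₀ hU hg hconv hKU hx₀ hmin =>
    norm_integral_smul_cexp_le_integral_inv_one_add μ hU hg hconv hK hKU hx₀ hmin hη
      (hηρ.trans (Metric.closedBall_subset_closedBall hρR.le)) hχ
      ((tsupport_mul_subset_right).trans b.tsupport_eq.subset) hηχ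
      ((norm_nonneg _).trans (hM (c, c) ⟨hcR, hcR⟩))
      fun x hx => (le_abs_self _).trans (hM (x₀, x) ⟨hx₀, hx⟩)⟩

end UniformDecay

/-! ### Graphs -/

section GraphMap

variable {E V : Type*} [NormedAddCommGroup E] [InnerProductSpace ℝ E]
  [NormedAddCommGroup V] [InnerProductSpace ℝ V]

/-- The parametrization `x ↦ A⁻¹ (x, f x)` of a graph placed in space by the rigid motion `A⁻¹`. -/
noncomputable def graphMap (A : V ≃ᵃⁱ[ℝ] WithLp 2 (E × ℝ)) (f : E → ℝ) (x : E) : V :=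
  A.symm (WithLp.toLp 2 (x, f x))

/-- The linear part of `A⁻¹`, on the plain product. -/
noncomputable def graphFrame (A : V ≃ᵃⁱ[ℝ] WithLp 2 (E × ℝ)) : E × ℝ →L[ℝ] V :=
  (A.symm.linearIsometryEquiv.toContinuousLinearEquiv : WithLp 2 (E × ℝ) →L[ℝ] V) ∘L
    ((WithLp.prodContinuousLinearEquiv 2 ℝ E ℝ).symm : E × ℝ →L[ℝ] WithLp 2 (E × ℝ))

/-- The derivative of `graphMap A f` at a point where `f` has derivative `l`. -/
noncomputable def graphDeriv (A : V ≃ᵃⁱ[ℝ] WithLp 2 (E × ℝ)) (l : E →L[ℝ] ℝ) : E →L[ℝ] V :=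
  graphFrame A ∘L (ContinuousLinearMap.id ℝ E).prod l

/-- The density of surface measure, in the coordinate `x`, on a graph whose height function has
derivative `l`. -/
noncomputable def graphDensity (l : E →L[ℝ] ℝ) : ℝ :=
  √(1 + ‖l‖ ^ 2)

variable {A : V ≃ᵃⁱ[ℝ] WithLp 2 (E × ℝ)} {f : E → ℝ} {x : E} {l : E →L[ℝ] ℝ}

theorem symm_eq_graphFrame_add (y : WithLp 2 (E × ℝ)) :
    A.symm y = graphFrame A (y.fst, y.snd) + A.symm 0 := by
  have := A.symm.map_vadd 0 y
  rwa [vadd_eq_add, vadd_eq_add, add_zero] at this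

theorem graphMap_eq_graphFrame_add : graphMap A f = fun x => graphFrame A (x, f x) + A.symm 0 :=
  funext fun _ => symm_eq_graphFrame_add _

theorem fst_graphMap (x : E) : (A (graphMap A f x)).fst = x := by
  simp [graphMap]

theorem snd_graphMap (x : E) : (A (graphMap A f x)).snd = f x := by
  simp [graphMap]

theorem graphMap_injective : Function.Injective (graphMap A f) :=
  Function.LeftInverse.injective (g := fun y => (A y).fst) fst_graphMap

theorem hasFDerivAt_graphMap (hf : HasFDerivAt f l x) :
    HasFDerivAt (graphMap A f) (graphDeriv A l) x := by
  rw [graphMap_eq_graphFrame_add]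
  exact ((graphFrame A).hasFDerivAt.comp x ((hasFDerivAt_id x).prodMk hf)).add_const _

theorem contDiffAt_graphMap {m : WithTop ℕ∞} (hf : ContDiffAt ℝ m f x) :
    ContDiffAt ℝ m (graphMap A f) x := by
  rw [graphMap_eq_graphFrame_add]
  exact ((graphFrame A).contDiff.contDiffAt.comp x (contDiffAt_id.prodMk hf)).add contDiffAt_const

theorem inner_graphFrame (p q : E × ℝ) :
    inner ℝ (graphFrame A p) (graphFrame A q) = inner ℝ p.1 q.1 + p.2 * q.2 := by
  change inner ℝ (A.symm.linearIsometryEquiv (WithLp.toLp 2 p))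
    (A.symm.linearIsometryEquiv (WithLp.toLp 2 q)) = _
  rw [LinearIsometryEquiv.inner_map_map, WithLp.prod_inner_apply]
  simp [mul_comm]

theorem inner_graphMap (A : V ≃ᵃⁱ[ℝ] WithLp 2 (E × ℝ)) (f : E → ℝ) (v : V) (x : E) :
    inner ℝ v (graphMap A f x) = inner ℝ (A.linearIsometryEquiv v).fst x +
      (A.linearIsometryEquiv v).snd * f x + inner ℝ v (A.symm 0) := by
  have hv : v = graphFrame A ((A.linearIsometryEquiv v).fst, (A.linearIsometryEquiv v).snd) :=
    (A.linearIsometryEquiv.symm_apply_apply v).symm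
  rw [graphMap_eq_graphFrame_add, inner_add_right]
  nth_rw 1 [hv]
  rw [inner_graphFrame]

theorem injective_graphDeriv (A : V ≃ᵃⁱ[ℝ] WithLp 2 (E × ℝ)) (l : E →L[ℝ] ℝ) :
    Function.Injective (graphDeriv A l) := by
  refine Function.Injective.comp (g := graphFrame A) ?_ fun u v h => congrArg Prod.fst h
  exact A.symm.linearIsometryEquiv.injective.comp (WithLp.toLp_injective 2)

theorem dist_fst_le (A : V ≃ᵃⁱ[ℝ] WithLp 2 (E × ℝ)) (y z : V) :
    dist (A y).fst (A z).fst ≤ dist y z := by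
  rw [← A.dist_map y z, dist_eq_norm, dist_eq_norm, ← WithLp.sub_fst]
  refine abs_le_of_sq_le_sq' ?_ (norm_nonneg _) |>.2
  rw [WithLp.prod_norm_sq_eq_of_L2]
  exact le_add_of_nonneg_right (sq_nonneg _)

theorem sum_sq_apply_orthonormalBasis [CompleteSpace E] {ι : Type*} [Fintype ι]
    (b : OrthonormalBasis ι ℝ E) (l : E →L[ℝ] ℝ) : ∑ i, l (b i) ^ 2 = ‖l‖ ^ 2 := by
  rw [← (InnerProductSpace.toDual ℝ E).symm.norm_map, ← b.sum_sq_norm_inner_right]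
  exact Finset.sum_congr rfl fun i _ => by
    rw [Real.norm_eq_abs, sq_abs, real_inner_comm, InnerProductSpace.toDual_symm_apply]

variable [FiniteDimensional ℝ E]

theorem normDet_graphDeriv (A : V ≃ᵃⁱ[ℝ] WithLp 2 (E × ℝ)) (l : E →L[ℝ] ℝ) :
    (graphDeriv A l).toLinearMap.normDet = graphDensity l := by
  set b := stdOrthonormalBasis ℝ E
  have gram : Matrix.gram ℝ (fun i => (graphDeriv A l).toLinearMap (b i)) =
      1 + Matrix.replicateCol Unit (fun i => l (b i)) *
        Matrix.replicateRow Unit (fun i => l (b i)) := by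
    ext i j
    have : inner ℝ (graphDeriv A l (b i)) (graphDeriv A l (b j)) =
      inner ℝ (b i) (b j) + l (b i) * l (b j) := inner_graphFrame _ _
    simp [Matrix.gram_apply, this, orthonormal_iff_ite.mp b.orthonormal i j, Matrix.one_apply,
      Matrix.mul_apply]
  have hdet := (graphDeriv A l).toLinearMap.normDet_sq_eq_det_gram b
  rw [gram, Matrix.det_one_add_replicateCol_mul_replicateRow] at hdet
  rw [graphDensity, eq_comm, Real.sqrt_eq_iff_eq_sq (by positivity) (LinearMap.normDet_nonneg _),
    ← sum_sq_apply_orthonormalBasis b]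
  simpa [dotProduct, sq] using hdet.symm

theorem contDiff_graphDensity {m : WithTop ℕ∞} :
    ContDiff ℝ m (graphDensity : (E →L[ℝ] ℝ) → ℝ) := by
  refine ContDiff.sqrt (contDiff_const.add ?_) fun l => by positivity
  simp only [← sum_sq_apply_orthonormalBasis (stdOrthonormalBasis ℝ E)]
  exact ContDiff.sum fun i _ => (contDiff_id.clm_apply contDiff_const).pow 2

theorem contDiffAt_graphDensity_fderiv (hf : ContDiffAt ℝ 2 f x) :
    ContDiffAt ℝ 1 (fun x => graphDensity (fderiv ℝ f x)) x :=
  contDiff_graphDensity.contDiffAt.comp x (hf.fderiv_right (m := 1) one_add_one_eq_two.le)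

end GraphMap

section Convexity

variable {E : Type*} [AddCommGroup E] [Module ℝ E] {U : Set E} {f : E → ℝ}

theorem convexOn_of_exists_subgradient (hU : Convex ℝ U)
    (hf : ∀ z ∈ U, ∃ l : E →ₗ[ℝ] ℝ, ∀ y ∈ U, f z + l (y - z) ≤ f y) : ConvexOn ℝ U f := by
  refine ⟨hU, fun x hx y hy a b ha hb hab => ?_⟩
  obtain ⟨l, hl⟩ := hf _ (hU hx hy ha hb hab)
  set z := a • x + b • y with hz
  have hl₀ : a * l (x - z) + b * l (y - z) = 0 := by
    rw [← smul_eq_mul, ← smul_eq_mul, ← map_smul, ← map_smul, ← map_add, smul_sub, smul_sub,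
      sub_add_sub_comm, ← hz, ← add_smul, hab, one_smul, sub_self, map_zero]
  calc f z = (a + b) * f z + (a * l (x - z) + b * l (y - z)) := by rw [hab, hl₀, one_mul, add_zero]
    _ = a * (f z + l (x - z)) + b * (f z + l (y - z)) := by ring
    _ ≤ a • f x + b • f y :=
      add_le_add (mul_le_mul_of_nonneg_left (hl x hx) ha) (mul_le_mul_of_nonneg_left (hl y hy) hb)

theorem convexOn_or_concaveOn_const_mul (hf : ConvexOn ℝ U f ∨ ConcaveOn ℝ U f) (c : ℝ) :
    ConvexOn ℝ U (fun x => c * f x) ∨ ConcaveOn ℝ U fun x => c * f x := by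
  rcases le_total 0 c with hc | hc
  · exact hf.imp (fun h => h.smul hc) fun h => h.smul hc
  · have hneg : (fun x => c * f x) = -fun x => -c * f x := by ext; simp
    rw [hneg]
    exact hf.symm.imp (fun h => (h.smul (neg_nonneg.2 hc)).neg)
      fun h => (h.smul (neg_nonneg.2 hc)).neg

theorem forall_pos_or_forall_neg_of_isPreconnected {X : Type*} [TopologicalSpace X] {s : Set X}
    (hs : IsPreconnected s) {G : X → ℝ} (hG : ContinuousOn G s) (hG₀ : ∀ x ∈ s, G x ≠ 0) :
    (∀ x ∈ s, 0 < G x) ∨ ∀ x ∈ s, G x < 0 := by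
  by_contra! ⟨⟨x, hx, hGx⟩, y, hy, hGy⟩
  obtain ⟨z, hz, hGz⟩ := hs.intermediate_value hx hy hG ⟨hGx, hGy⟩
  exact hG₀ z hz hGz

end Convexity

section ConvexGraph

variable {E V : Type*} [NormedAddCommGroup E] [InnerProductSpace ℝ E]
  [NormedAddCommGroup V] [InnerProductSpace ℝ V]

/-- The height of `z` above the hyperplane tangent at `x` to the graph of `f`, in the coordinates
given by `A`. -/
noncomputable def tangentGap (A : V ≃ᵃⁱ[ℝ] WithLp 2 (E × ℝ)) (f : E → ℝ) (x : E) (z : V) : ℝ :=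
  (A z).snd - f x - fderiv ℝ f x ((A z).fst - x)

variable {A : V ≃ᵃⁱ[ℝ] WithLp 2 (E × ℝ)} {f : E → ℝ} {x : E} {U : Set E} {Ω : Set V}

theorem tangentGap_graphMap (x y : E) :
    tangentGap A f x (graphMap A f y) = f y - f x - fderiv ℝ f x (y - x) := by
  rw [tangentGap, fst_graphMap, snd_graphMap]

theorem sub_graphMap_eq (A : V ≃ᵃⁱ[ℝ] WithLp 2 (E × ℝ)) (f : E → ℝ) (x : E) (z : V) :
    z - graphMap A f x = graphDeriv A (fderiv ℝ f x) ((A z).fst - x) +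
      tangentGap A f x z • graphFrame A (0, 1) := by
  have hz : z = graphFrame A ((A z).fst, (A z).snd) + A.symm 0 := by
    rw [← symm_eq_graphFrame_add, A.symm_apply_apply]
  rw [graphMap_eq_graphFrame_add]
  nth_rw 1 [hz]
  rw [add_sub_add_right_eq_sub, ← map_sub, ← map_smul]
  change _ = graphFrame A ((A z).fst - x, fderiv ℝ f x ((A z).fst - x)) + _
  rw [← map_add]
  simp [tangentGap]

theorem exists_mul_tangentGap_neg (hΩ : Convex ℝ Ω) (hΩo : IsOpen Ω) (hf : DifferentiableAt ℝ f x)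
    (hU : U ∈ 𝓝 x) (hfΩ : Set.MapsTo (graphMap A f) U (frontier Ω)) :
    ∃ c : ℝ, (∀ z ∈ Ω, c * tangentGap A f x z < 0) ∧
      ∀ z ∈ frontier Ω, c * tangentGap A f x z ≤ 0 := by
  have hx : graphMap A f x ∈ frontier Ω := hfΩ (mem_of_mem_nhds hU)
  rw [hΩo.frontier_eq] at hx
  obtain ⟨l, hl⟩ := geometric_hahn_banach_open_point hΩ hΩo hx.2
  have hl_frontier : ∀ z ∈ frontier Ω, l z ≤ l (graphMap A f x) := fun z hz =>
    closure_minimal (fun a ha => (hl a ha).le) (isClosed_le l.continuous continuous_const)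
      (frontier_subset_closure hz)
  have hmax : IsLocalMax (fun y => l (graphMap A f y)) x := by
    filter_upwards [hU] with y hy using hl_frontier _ (hfΩ hy)
  have l_tangent : l ∘L graphDeriv A (fderiv ℝ f x) = 0 :=
    hmax.hasFDerivAt_eq_zero (l.hasFDerivAt.comp x (hasFDerivAt_graphMap hf.hasFDerivAt))
  have l_sub : ∀ z, l (graphFrame A (0, 1)) * tangentGap A f x z = l z - l (graphMap A f x) :=
    fun z => by
      have : l (graphDeriv A (fderiv ℝ f x) ((A z).fst - x)) = 0 :=
        congrArg (fun T : E →L[ℝ] ℝ => T ((A z).fst - x)) l_tangent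
      rw [← map_sub, sub_graphMap_eq, map_add, this, zero_add, map_smul, smul_eq_mul, mul_comm]
  refine ⟨l (graphFrame A (0, 1)), fun z hz => ?_, fun z hz => ?_⟩
  · rw [l_sub]
    exact sub_neg.2 (hl z hz)
  · rw [l_sub]
    exact sub_nonpos.2 (hl_frontier z hz)

/-- A supporting hyperplane at a point of the graph is tangent to it there, and on a connected
patch a fixed point of the convex set always lies on the same side of the tangent hyperplanes. -/
theorem convexOn_or_concaveOn_of_mapsTo_frontier (hΩ : Convex ℝ Ω) (hΩo : IsOpen Ω)
    (hΩne : Ω.Nonempty) (hUo : IsOpen U) (hU : Convex ℝ U) (hf : ContDiffOn ℝ 1 f U)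
    (hfΩ : Set.MapsTo (graphMap A f) U (frontier Ω)) : ConvexOn ℝ U f ∨ ConcaveOn ℝ U f := by
  obtain ⟨z, hz⟩ := hΩne
  have hf' : ∀ x ∈ U, ContDiffAt ℝ 1 f x := fun x hx => hf.contDiffAt (hUo.mem_nhds hx)
  choose! c hc hc_frontier using fun x (hx : x ∈ U) => exists_mul_tangentGap_neg hΩ hΩo
    ((hf' x hx).differentiableAt one_ne_zero) (hUo.mem_nhds hx) hfΩ
  have gap_cont : ContinuousOn (fun x => tangentGap A f x z) U := fun x hx =>
    ((continuousAt_const.sub (hf' x hx).continuousAt).sub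
      (((hf' x hx).fderiv_right (m := 0) (by norm_num)).continuousAt.clm_apply
        (continuousAt_const.sub continuousAt_id))).continuousWithinAt
  have gap_ne : ∀ x ∈ U, tangentGap A f x z ≠ 0 := fun x hx h => by
    simpa [h] using hc x hx z hz
  rcases forall_pos_or_forall_neg_of_isPreconnected hU.isPreconnected gap_cont gap_ne with h | h
  · refine .inl (convexOn_of_exists_subgradient hU fun x hx => ⟨fderiv ℝ f x, fun y hy => ?_⟩)
    have : 0 ≤ tangentGap A f x (graphMap A f y) :=
      nonneg_of_mul_nonpos_right (hc_frontier x hx _ (hfΩ hy))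
        (neg_of_mul_neg_left (hc x hx z hz) (h x hx).le)
    rw [tangentGap_graphMap] at this
    exact add_le_of_le_sub_left (sub_nonneg.1 this)
  · refine .inr (neg_convexOn_iff.1
      (convexOn_of_exists_subgradient hU fun x hx => ⟨-fderiv ℝ f x, fun y hy => ?_⟩))
    have : tangentGap A f x (graphMap A f y) ≤ 0 :=
      nonpos_of_mul_nonpos_right (hc_frontier x hx _ (hfΩ hy))
        (pos_of_mul_neg_left (hc x hx z hz) (h x hx).le)
    rw [tangentGap_graphMap] at this
    change -f x + -fderiv ℝ f x (y - x) ≤ -f y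
    linarith

theorem convexOn_or_concaveOn_inner_graphMap (hf : ConvexOn ℝ U f ∨ ConcaveOn ℝ U f) (v : V) :
    ConvexOn ℝ U (fun x => inner ℝ v (graphMap A f x)) ∨
      ConcaveOn ℝ U fun x => inner ℝ v (graphMap A f x) := by
  have hU : Convex ℝ U := hf.elim (·.1) (·.1)
  set w := A.linearIsometryEquiv v
  have hlin : (fun x => inner ℝ v (graphMap A f x)) = fun x =>
      innerₛₗ ℝ w.fst x + w.snd * f x + inner ℝ v (A.symm 0) := funext (inner_graphMap A f v)
  rw [hlin]
  exact (convexOn_or_concaveOn_const_mul hf w.snd).imp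
    (fun h => (((innerₛₗ ℝ w.fst).convexOn hU).add h).add_const _)
    fun h => (((innerₛₗ ℝ w.fst).concaveOn hU).add h).add_const _

end ConvexGraph

/-! ### Surface measure in a graph chart -/

section GraphPatch

variable {E V : Type*} [NormedAddCommGroup E] [InnerProductSpace ℝ E]
  [NormedAddCommGroup V] [InnerProductSpace ℝ V]

/-- The part of the graph of `f` over the open set `U`, placed in space by `A⁻¹`, is a `C²` patch
contained in `S`. -/
structure IsGraphPatch (S : Set V) (A : V ≃ᵃⁱ[ℝ] WithLp 2 (E × ℝ)) (f : E → ℝ) (U : Set E) :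
    Prop where
  isOpen : IsOpen U
  contDiffOn : ContDiffOn ℝ 2 f U
  mapsTo : Set.MapsTo (graphMap A f) U S

/-- The function on coordinate space whose Lebesgue integral is the surface integral of `ψ` over
the patch of the graph above `U`. -/
noncomputable def graphAmplitude (A : V ≃ᵃⁱ[ℝ] WithLp 2 (E × ℝ)) (f : E → ℝ) (U : Set E)
    (ψ : V → ℝ) : E → ℝ :=
  U.indicator fun x => graphDensity (fderiv ℝ f x) * ψ (graphMap A f x)

variable {S : Set V} {A : V ≃ᵃⁱ[ℝ] WithLp 2 (E × ℝ)} {f : E → ℝ} {U : Set E} {x : E}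

theorem IsGraphPatch.contDiffAt (h : IsGraphPatch S A f U) (hx : x ∈ U) : ContDiffAt ℝ 2 f x :=
  h.contDiffOn.contDiffAt (h.isOpen.mem_nhds hx)

theorem IsGraphPatch.hasFDerivAt_graphMap (h : IsGraphPatch S A f U) (hx : x ∈ U) :
    HasFDerivAt (graphMap A f) (graphDeriv A (fderiv ℝ f x)) x :=
  _root_.hasFDerivAt_graphMap ((h.contDiffAt hx).differentiableAt two_ne_zero).hasFDerivAt

theorem IsGraphPatch.contDiffOn_inner (h : IsGraphPatch S A f U) (v : V) :
    ContDiffOn ℝ 2 (fun x => inner ℝ v (graphMap A f x)) U := fun _ hx =>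
  (contDiffAt_const.inner ℝ (contDiffAt_graphMap (h.contDiffAt hx))).contDiffWithinAt

variable [FiniteDimensional ℝ E]

theorem IsGraphPatch.setIntegral_image_graphMap [CompleteSpace V] [MeasurableSpace E]
    [BorelSpace E] [MeasurableSpace V] [BorelSpace V] {F : Type*} [NormedAddCommGroup F]
    [NormedSpace ℝ F] (h : IsGraphPatch S A f U) (G : V → F) :
    ∫ y in graphMap A f '' U, G y ∂μHE[Module.finrank ℝ E] =
      ∫ x in U, graphDensity (fderiv ℝ f x) • G (graphMap A f x) := by
  have hf' : ContinuousOn (fderiv ℝ f) U := fun x hx =>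
    ((h.contDiffAt hx).fderiv_right (m := 0) (by norm_num)).continuousAt.continuousWithinAt
  have hcont : ContinuousOn (fun x => graphDeriv A (fderiv ℝ f x)) U :=
    continuousOn_const.clm_comp
      ((ContinuousLinearMap.prodₗᵢ (𝕜 := ℝ) (E := E) (F := E) (G := ℝ)
        ℝ).continuous.comp_continuousOn (continuousOn_const.prodMk hf'))
  rw [integral_image_eq_integral_normDet_fderiv_smul h.isOpen
    (fun x hx => h.hasFDerivAt_graphMap hx) hcont (fun x _ => injective_graphDeriv A _)
    graphMap_injective.injOn]
  simp only [normDet_graphDeriv]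

theorem IsGraphPatch.contDiff_graphAmplitude (h : IsGraphPatch S A f U) {ψ : V → ℝ}
    (hψ : ∀ y ∈ S, ContDiffAt ℝ 1 ψ y) (hsupp : tsupport (graphAmplitude A f U ψ) ⊆ U) :
    ContDiff ℝ 1 (graphAmplitude A f U ψ) :=
  contDiff_of_contDiffAt_tsupport fun x hx =>
    ((contDiffAt_graphDensity_fderiv (h.contDiffAt (hsupp hx))).mul
      ((hψ _ (h.mapsTo (hsupp hx))).comp x
        ((contDiffAt_graphMap (h.contDiffAt (hsupp hx))).of_le one_le_two))).congr_of_eventuallyEq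
      (Set.eqOn_indicator.eventuallyEq_of_mem (h.isOpen.mem_nhds (hsupp hx)))

end GraphPatch

section SurfaceMeasure

variable {n : ℕ} {S : Set (EuclideanSpace ℝ (Fin (n + 1)))}
  {ψ : EuclideanSpace ℝ (Fin (n + 1)) → ℝ}
  {A : EuclideanSpace ℝ (Fin (n + 1)) ≃ᵃⁱ[ℝ] WithLp 2 (EuclideanSpace ℝ (Fin n) × ℝ)}
  {f : EuclideanSpace ℝ (Fin n) → ℝ} {U : Set (EuclideanSpace ℝ (Fin n))}

theorem IsC2Hypersurface.exists_isGraphPatch (hS : IsC2Hypersurface n S)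
    {p : EuclideanSpace ℝ (Fin (n + 1))} (hp : p ∈ S) :
    ∃ (A : EuclideanSpace ℝ (Fin (n + 1)) ≃ᵃⁱ[ℝ] WithLp 2 (EuclideanSpace ℝ (Fin n) × ℝ))
      (f : EuclideanSpace ℝ (Fin n) → ℝ) (r : ℝ), 0 < r ∧ (A p).fst = 0 ∧
      IsGraphPatch S A f (Metric.ball 0 r) ∧
      ∀ y ∈ S, dist y p < r → graphMap A f (A y).fst = y := by
  obtain ⟨A, f, hAp, hf, hf₀, -, hloc⟩ := hS p hp
  have hΦ₀ : graphMap A f 0 = p := by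
    rw [graphMap, hf₀, ← A.symm_apply_apply p, hAp]
    rfl
  obtain ⟨ρ, hρ, hρS⟩ := Metric.eventually_nhds_iff.mp hloc
  have near_p : ∀ᶠ x in 𝓝 0, dist (graphMap A f x) p < ρ := by
    have := (contDiffAt_graphMap (A := A) hf).continuousAt
    rw [ContinuousAt, hΦ₀] at this
    exact this.eventually (Metric.ball_mem_nhds p hρ)
  obtain ⟨r, hr, hball⟩ := Metric.eventually_nhds_iff_ball.mp
    (near_p.and (hf.eventually (by simp)))
  have hle := Metric.ball_subset_ball (x := (0 : EuclideanSpace ℝ (Fin n))) (min_le_left r ρ)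
  refine ⟨A, f, min r ρ, lt_min hr hρ, by rw [hAp]; rfl,
    ⟨Metric.isOpen_ball, fun x hx => (hball x (hle hx)).2.contDiffWithinAt, fun x hx => ?_⟩,
    fun y hy hyp => ?_⟩
  · rw [hρS (hball x (hle hx)).1, fst_graphMap, snd_graphMap]
  · rw [graphMap, ← (hρS (hyp.trans_le (min_le_right _ _))).1 hy]
    exact A.symm_apply_apply y

theorem BoundsConvexDomain.convexOn_or_concaveOn (hS : BoundsConvexDomain S)
    (h : IsGraphPatch S A f U) (hU : Convex ℝ U) : ConvexOn ℝ U f ∨ ConcaveOn ℝ U f := by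
  obtain ⟨Ω, hne, hΩo, hΩ, -, rfl⟩ := hS
  exact convexOn_or_concaveOn_of_mapsTo_frontier hΩ hΩo hne h.isOpen hU
    (h.contDiffOn.of_le one_le_two) h.mapsTo

theorem IsC2Hypersurface.isFiniteMeasure_surfaceMeasure (hS : IsC2Hypersurface n S)
    (hSc : IsCompact S) : IsFiniteMeasure (surfaceMeasure S) := by
  refine ⟨?_⟩
  rw [surfaceMeasure, Measure.restrict_apply_univ]
  refine hSc.measure_lt_top_of_nhdsWithin fun p hp => ?_
  obtain ⟨A, f, r, hr, hAp, h, hloc⟩ := hS.exists_isGraphPatch hp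
  obtain ⟨K, T, hT, hlip⟩ := ((contDiffAt_graphMap (A := A)
    (h.contDiffAt (Metric.mem_ball_self hr))).of_le one_le_two).exists_lipschitzOnWith
  obtain ⟨ε, hε, hεT⟩ := Metric.mem_nhds_iff.mp hT
  refine ⟨S ∩ Metric.ball p (min r ε),
    inter_mem_nhdsWithin S (Metric.ball_mem_nhds p (lt_min hr hε)), ?_⟩
  have hsub : S ∩ Metric.ball p (min r ε) ⊆ graphMap A f '' Metric.ball 0 ε := fun y hy =>
    ⟨(A y).fst, by
      have := (dist_fst_le A y p).trans_lt (hy.2.trans_le (min_le_right r ε))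
      rwa [hAp] at this, hloc y hy.1 (hy.2.trans_le (min_le_left r ε))⟩
  calc μHE[n] (S ∩ Metric.ball p (min r ε))
      ≤ μHE[n] (graphMap A f '' Metric.ball 0 ε) := measure_mono hsub
    _ ≤ K ^ n * μHE[n] (id '' Metric.ball (0 : EuclideanSpace ℝ (Fin n)) ε) :=
        euclideanHausdorffMeasure_image_le_of_dist_le n fun x hx y hy =>
          hlip.dist_le_mul x (hεT hx) y (hεT hy)
    _ < ⊤ := by
        rw [Set.image_id, EuclideanSpace.euclideanHausdorffMeasure_eq_volume]
        exact ENNReal.mul_lt_top (by simp) measure_ball_lt_top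

theorem IsGraphPatch.volume_le_surfaceMeasure_image (h : IsGraphPatch S A f U)
    {T : Set (EuclideanSpace ℝ (Fin n))} (hT : T ⊆ U) :
    volume T ≤ surfaceMeasure S (graphMap A f '' T) := by
  rw [surfaceMeasure, Measure.restrict_eq_self _ ((Set.image_mono hT).trans h.mapsTo.image_subset)]
  simpa [EuclideanSpace.euclideanHausdorffMeasure_eq_volume] using
    euclideanHausdorffMeasure_image_le_of_dist_le (Φ := id) (Ψ := graphMap A f) (K := 1) (s := T) n
      fun x _ y _ => by simpa [fst_graphMap] using dist_fst_le A (graphMap A f x) (graphMap A f y)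

theorem IsGraphPatch.surfaceFourier_eq_integral (h : IsGraphPatch S A f U) (hS : MeasurableSet S)
    (hψ : ∀ y ∈ S, y ∉ graphMap A f '' U → ψ y = 0) (ξ : EuclideanSpace ℝ (Fin (n + 1))) :
    surfaceFourier S ψ ξ = ∫ x, graphAmplitude A f U ψ x •
      Complex.exp (Complex.I * (inner ℝ (-ξ) (graphMap A f x) : ℝ)) := by
  have hn : Module.finrank ℝ (EuclideanSpace ℝ (Fin n)) = n := finrank_euclideanSpace_fin
  have himage := h.setIntegral_image_graphMap fun y =>
    Complex.exp (-Complex.I * (inner ℝ ξ y : ℝ)) * (ψ y : ℂ)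
  rw [hn] at himage
  rw [surfaceFourier, surfaceMeasure, setIntegral_eq_of_subset_of_forall_sdiff_eq_zero hS
    h.mapsTo.image_subset fun y hy => by simp [hψ y hy.1 hy.2], himage,
    ← integral_indicator h.isOpen.measurableSet]
  congr with x
  by_cases hx : x ∈ U
  · simp only [graphAmplitude, Set.indicator_of_mem hx, Complex.real_smul, inner_neg_left]
    push_cast
    ring_nf
  · simp [graphAmplitude, Set.indicator_of_notMem hx]

theorem SlabBound.surfaceMeasure_le {α C : ℝ} (h : SlabBound S α C)
    {v : EuclideanSpace ℝ (Fin (n + 1))} (hv : v ≠ 0) (a : ℝ) {s : ℝ} (hs : 0 < s) :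
    surfaceMeasure S {x | x ∈ S ∧ a ≤ inner ℝ v x ∧ inner ℝ v x ≤ a + s} ≤
      ENNReal.ofReal (C * ‖v‖ ^ (-α) * s ^ α) := by
  have hv' : 0 < ‖v‖ := norm_pos_iff.2 hv
  have ht : 0 < ‖v‖ / s := div_pos hv' hs
  have hinner : ∀ x, inner ℝ v x = ‖v‖ * inner ℝ x (‖v‖⁻¹ • v) := fun x => by
    rw [inner_smul_right, mul_inv_cancel_left₀ hv'.ne', real_inner_comm]
  have hbound := h (‖v‖⁻¹ • v) (norm_smul_inv_norm (𝕜 := ℝ) hv) (‖v‖ / s) ht.ne'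
  rw [abs_of_pos ht, Real.div_rpow hv'.le hs.le, Real.rpow_neg hs.le, div_inv_eq_mul,
    ← mul_assoc] at hbound
  refine (measure_mono ?_).trans (iSup_le_iff.1 hbound (a / ‖v‖))
  rintro x ⟨hx, hax, hxa⟩
  rw [hinner] at hax hxa
  refine ⟨hx, (div_le_iff₀' hv').2 hax, ?_⟩
  rw [abs_of_pos ht, inv_div, ← add_div]
  exact (le_div_iff₀' hv').2 hxa

end SurfaceMeasure

/-! ### From slab bounds to Fourier decay -/

section FourierDecay

theorem norm_integral_smul_cexp_neg {X : Type*} [MeasurableSpace X] (μ : Measure X)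
    (η g : X → ℝ) :
    ‖∫ x, η x • Complex.exp (Complex.I * (-g x : ℝ)) ∂μ‖ =
      ‖∫ x, η x • Complex.exp (Complex.I * g x) ∂μ‖ := by
  rw [← Complex.norm_conj, ← integral_conj]
  simp [← Complex.exp_conj]

variable {n : ℕ} {S : Set (EuclideanSpace ℝ (Fin (n + 1)))}
  {ψ : EuclideanSpace ℝ (Fin (n + 1)) → ℝ} {α C : ℝ}

theorem IsC1Near.contDiffAt (hψ : IsC1Near S ψ) {y : EuclideanSpace ℝ (Fin (n + 1))}
    (hy : y ∈ S) : ContDiffAt ℝ 1 ψ y :=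
  let ⟨_, hU, hSU, hψU⟩ := hψ
  hψU.contDiffAt (hU.mem_nhds (hSU hy))

theorem IsC1Near.continuousOn (hψ : IsC1Near S ψ) : ContinuousOn ψ S := fun _ hy =>
  (hψ.contDiffAt hy).continuousAt.continuousWithinAt

theorem IsC1Near.contDiff_mul (hψ : IsC1Near S ψ) {b : EuclideanSpace ℝ (Fin (n + 1)) → ℝ}
    (hb : ContDiff ℝ 1 b) : IsC1Near S (b * ψ) :=
  let ⟨U, hU, hSU, hψU⟩ := hψ
  ⟨U, hU, hSU, hb.contDiffOn.mul hψU⟩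

section Patch

variable {A : EuclideanSpace ℝ (Fin (n + 1)) ≃ᵃⁱ[ℝ] WithLp 2 (EuclideanSpace ℝ (Fin n) × ℝ)}
  {f : EuclideanSpace ℝ (Fin n) → ℝ} {U : Set (EuclideanSpace ℝ (Fin n))}

theorem IsGraphPatch.exists_norm_surfaceFourier_eq (h : IsGraphPatch S A f U)
    (hS : MeasurableSet S) (hf : ConvexOn ℝ U f ∨ ConcaveOn ℝ U f)
    (hψ : ∀ y ∈ S, y ∉ graphMap A f '' U → ψ y = 0) (ξ : EuclideanSpace ℝ (Fin (n + 1))) :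
    ∃ v : EuclideanSpace ℝ (Fin (n + 1)), ‖v‖ = ‖ξ‖ ∧
      ConvexOn ℝ U (fun x => inner ℝ v (graphMap A f x)) ∧
      ‖surfaceFourier S ψ ξ‖ = ‖∫ x, graphAmplitude A f U ψ x •
        Complex.exp (Complex.I * (inner ℝ v (graphMap A f x) : ℝ))‖ := by
  rw [h.surfaceFourier_eq_integral hS hψ]
  rcases convexOn_or_concaveOn_inner_graphMap hf (A := A) (-ξ) with hconv | hconc
  · exact ⟨-ξ, norm_neg ξ, hconv, rfl⟩
  · refine ⟨ξ, rfl, ?_, ?_⟩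
    · simpa only [inner_neg_left, Pi.neg_def, neg_neg] using hconc.neg
    · simp only [inner_neg_left]
      exact norm_integral_smul_cexp_neg _ _ _

theorem IsGraphPatch.integral_inv_one_add_le (h : IsGraphPatch S A f U)
    (hslab : SlabBound S α C) (hC : 0 ≤ C) (hα : α < 1) {K : Set (EuclideanSpace ℝ (Fin n))}
    (hK : MeasurableSet K) (hKU : K ⊆ U) {v : EuclideanSpace ℝ (Fin (n + 1))} (hv : v ≠ 0)
    {x₀ : EuclideanSpace ℝ (Fin n)}
    (hmin : IsMinOn (fun x => inner ℝ v (graphMap A f x)) K x₀) :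
    ∫ x in K, (1 + (inner ℝ v (graphMap A f x) - inner ℝ v (graphMap A f x₀)))⁻¹ ≤
      C * ‖v‖ ^ (-α) / (1 - α) := by
  refine integral_inv_one_add_le_of_measure_le (by positivity) hα
    (ae_restrict_of_forall_mem hK fun x hx => sub_nonneg.2 (hmin hx)) fun s hs => ?_
  rw [Measure.restrict_apply' hK]
  refine (h.volume_le_surfaceMeasure_image (Set.inter_subset_right.trans hKU)).trans
    ((measure_mono ?_).trans (hslab.surfaceMeasure_le hv (inner ℝ v (graphMap A f x₀)) hs))
  rintro _ ⟨x, ⟨hxs, hxK⟩, rfl⟩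
  exact ⟨h.mapsTo (hKU hxK), hmin hxK, sub_le_iff_le_add'.1 hxs⟩

theorem IsGraphPatch.exists_fourierBound (h : IsGraphPatch S A f U) (hS : MeasurableSet S)
    (hf : ConvexOn ℝ U f ∨ ConcaveOn ℝ U f) {c : EuclideanSpace ℝ (Fin n)} {ρ R : ℝ} (hρ : 0 < ρ)
    (hρR : ρ < R) (hRU : Metric.closedBall c R ⊆ U) (hψ : IsC1Near S ψ)
    (hψU : ∀ y ∈ S, y ∉ graphMap A f '' U → ψ y = 0)
    (hsupp : tsupport (graphAmplitude A f U ψ) ⊆ Metric.closedBall c ρ)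
    (hα : α < 1) (hC : 0 ≤ C) (hslab : SlabBound S α C) : ∃ C' : ℝ, FourierBound S ψ α C' := by
  have hη := h.contDiff_graphAmplitude (fun _ hy => hψ.contDiffAt hy)
    (hsupp.trans ((Metric.closedBall_subset_closedBall hρR.le).trans hRU))
  obtain ⟨M, hM₀, hM⟩ := exists_forall_norm_integral_smul_cexp_le volume hη hρ hρR hsupp
  refine ⟨M * (C / (1 - α)), fun ξ hξ => ?_⟩
  obtain ⟨v, hvξ, hconv, hFourier⟩ := h.exists_norm_surfaceFourier_eq hS hf hψU ξ
  have hv : v ≠ 0 := norm_ne_zero_iff.1 (hvξ ▸ norm_ne_zero_iff.2 hξ)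
  have hphase := h.contDiffOn_inner v
  obtain ⟨x₀, hx₀, hmin⟩ := (isCompact_closedBall c R).exists_isMinOn
    ⟨c, Metric.mem_closedBall_self (hρ.trans hρR).le⟩ (hphase.continuousOn.mono hRU)
  calc ‖surfaceFourier S ψ ξ‖
      ≤ M * ∫ x in Metric.closedBall c R,
          (1 + (inner ℝ v (graphMap A f x) - inner ℝ v (graphMap A f x₀)))⁻¹ :=
        hFourier.trans_le (hM U _ x₀ h.isOpen hphase hconv hRU hx₀ hmin)
    _ ≤ M * (C * ‖v‖ ^ (-α) / (1 - α)) := by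
        gcongr
        exact h.integral_inv_one_add_le hslab hC hα measurableSet_closedBall hRU hv hmin
    _ = M * (C / (1 - α)) * ‖ξ‖ ^ (-α) := by rw [hvξ]; ring

theorem tsupport_graphAmplitude_subset {p : EuclideanSpace ℝ (Fin (n + 1))} {ρ : ℝ}
    (hψ : Function.support ψ ⊆ Metric.closedBall p ρ) :
    tsupport (graphAmplitude A f U ψ) ⊆ Metric.closedBall (A p).fst ρ := by
  refine closure_minimal (fun x hx => ?_) Metric.isClosed_closedBall
  have hx' : graphMap A f x ∈ Function.support ψ :=
    right_ne_zero_of_mul (Set.indicator_apply_ne_zero.1 hx).2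
  have := (dist_fst_le A (graphMap A f x) p).trans (hψ hx')
  rwa [fst_graphMap] at this

end Patch

theorem exists_nhds_forall_exists_fourierBound (hSm : MeasurableSet S) (hS : IsC2Hypersurface n S)
    (hconv : BoundsConvexDomain S) (hα : α < 1) (hC : 0 ≤ C) (hslab : SlabBound S α C)
    {p : EuclideanSpace ℝ (Fin (n + 1))} (hp : p ∈ S) :
    ∃ W ∈ 𝓝 p, ∀ φ : EuclideanSpace ℝ (Fin (n + 1)) → ℝ, IsC1Near S φ →
      Function.support φ ⊆ W → ∃ C' : ℝ, FourierBound S φ α C' := by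
  obtain ⟨A, f, r, hr, hAp, h, hloc⟩ := hS.exists_isGraphPatch hp
  refine ⟨Metric.closedBall p (r / 4), Metric.closedBall_mem_nhds p (by positivity),
    fun φ hφ hφW => ?_⟩
  have hφ_image : ∀ y ∈ S, y ∉ graphMap A f '' Metric.ball 0 r → φ y = 0 := fun y hy hyU => by
    by_contra hφy
    have hyp : dist y p < r := (hφW hφy).trans_lt (by linarith)
    have hAy := (dist_fst_le A y p).trans_lt hyp
    exact hyU ⟨(A y).fst, by rwa [hAp] at hAy, hloc y hy hyp⟩
  exact h.exists_fourierBound hSm (hconv.convexOn_or_concaveOn h (convex_ball 0 r))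
    (by positivity) (by linarith : r / 4 < r / 2) (Metric.closedBall_subset_ball (by linarith)) hφ
    hφ_image (hAp ▸ tsupport_graphAmplitude_subset hφW) hα hC hslab

theorem integrable_surfaceMeasure_of_continuousOn [IsFiniteMeasure (surfaceMeasure S)]
    (hS : IsCompact S) {F : Type*} [NormedAddCommGroup F] {G : EuclideanSpace ℝ (Fin (n + 1)) → F}
    (hG : ContinuousOn G S) : Integrable G (surfaceMeasure S) := by
  obtain ⟨M, hM⟩ := hS.exists_bound_of_continuousOn hG
  exact .of_bound (hG.aestronglyMeasurable_of_isCompact hS hS.measurableSet) M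
    (ae_restrict_of_forall_mem hS.measurableSet hM)

theorem surfaceFourier_congr (hS : MeasurableSet S)
    {φ : EuclideanSpace ℝ (Fin (n + 1)) → ℝ} (h : Set.EqOn ψ φ S) :
    surfaceFourier S ψ = surfaceFourier S φ :=
  funext fun _ => setIntegral_congr_fun hS fun x hx => by simp only [h hx]

theorem surfaceFourier_sum [IsFiniteMeasure (surfaceMeasure S)] (hS : IsCompact S) {ι : Type*}
    (T : Finset ι) {φ : ι → EuclideanSpace ℝ (Fin (n + 1)) → ℝ}
    (hφ : ∀ i ∈ T, ContinuousOn (φ i) S) (ξ : EuclideanSpace ℝ (Fin (n + 1))) :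
    surfaceFourier S (∑ i ∈ T, φ i) ξ = ∑ i ∈ T, surfaceFourier S (φ i) ξ := by
  have integrable : ∀ i ∈ T, Integrable (fun x =>
      Complex.exp (-Complex.I * (inner ℝ ξ x : ℝ)) * (φ i x : ℂ)) (surfaceMeasure S) :=
    fun i hi => integrable_surfaceMeasure_of_continuousOn hS <|
      (by fun_prop : Continuous fun x : EuclideanSpace ℝ (Fin (n + 1)) =>
        Complex.exp (-Complex.I * (inner ℝ ξ x : ℝ))).continuousOn.mul
        (Complex.continuous_ofReal.comp_continuousOn (hφ i hi))
  simp only [surfaceFourier, Finset.sum_apply, Complex.ofReal_sum, Finset.mul_sum]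
  exact integral_finsetSum T integrable

theorem exists_fourierBound_of_locally [IsFiniteMeasure (surfaceMeasure S)] (hS : IsCompact S)
    (hloc : ∀ p ∈ S, ∃ W ∈ 𝓝 p, ∀ φ : EuclideanSpace ℝ (Fin (n + 1)) → ℝ, IsC1Near S φ →
      Function.support φ ⊆ W → ∃ C' : ℝ, FourierBound S φ α C')
    (hψ : IsC1Near S ψ) : ∃ C' : ℝ, FourierBound S ψ α C' := by
  choose! W hW hbound using hloc
  obtain ⟨T, hTS, hcov⟩ := hS.elim_nhds_subcover (fun p => interior (W p)) fun p hp =>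
    interior_mem_nhds.2 (hW p hp)
  obtain ⟨b, hb⟩ := SmoothPartitionOfUnity.exists_isSubordinate
    (modelWithCornersSelf ℝ (EuclideanSpace ℝ (Fin (n + 1)))) hS.isClosed
    (fun p : T => interior (W p)) (fun _ => isOpen_interior)
    (by simpa [Set.iUnion_subtype] using hcov)
  have hφ (p : T) : IsC1Near S (b p * ψ) :=
    hψ.contDiff_mul ((b p).contMDiff.contDiff.of_le (by simp))
  choose C' hC' using fun p : T => hbound p (hTS p p.2) (b p * ψ) (hφ p)
    ((Function.support_mul_subset_left _ _).trans
      ((subset_tsupport _).trans ((hb p).trans interior_subset)))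
  have hsum : Set.EqOn ψ (∑ p, b p * ψ) S := fun x hx => by
    have := b.sum_eq_one hx
    rw [finsum_eq_sum_of_fintype] at this
    rw [← Finset.sum_mul, Pi.mul_apply, Finset.sum_apply, this, one_mul]
  refine ⟨∑ p, C' p, fun ξ hξ => ?_⟩
  rw [surfaceFourier_congr hS.measurableSet hsum,
    surfaceFourier_sum hS _ fun p _ => (hφ p).continuousOn, Finset.sum_mul]
  exact (norm_sum_le _ _).trans (Finset.sum_le_sum fun p _ => hC' p ξ hξ)

end FourierDecay

/-! ### From Fourier decay to slab bounds -/

section GaussianAverage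

open ProbabilityTheory

theorem integrable_abs_rpow_gaussianReal {v : NNReal} (hv : v ≠ 0) {s : ℝ} (hs : -1 < s) :
    Integrable (fun ξ : ℝ => |ξ| ^ s) (gaussianReal 0 v) := by
  rw [gaussianReal_of_var_ne_zero 0 hv, gaussianPDF_def,
    integrable_withDensity_iff (by fun_prop) (by simp)]
  have h : Integrable fun ξ : ℝ => ‖ξ‖ ^ s * Real.exp (-(2 * v : ℝ)⁻¹ * ‖ξ‖ ^ 2) := by
    rw [integrable_fun_norm_addHaar volume
      (f := fun r : ℝ => r ^ s * Real.exp (-(2 * v : ℝ)⁻¹ * r ^ 2))]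
    simpa using integrableOn_rpow_mul_exp_neg_mul_sq (b := (2 * v : ℝ)⁻¹) (by positivity) hs
  refine (h.const_mul (√(2 * Real.pi * v))⁻¹).congr (ae_of_all _ fun ξ => ?_)
  have := ENNReal.toReal_ofReal (gaussianPDFReal_nonneg 0 v ξ)
  simp only [this]
  simp only [gaussianPDFReal, Real.norm_eq_abs, sq_abs, sub_zero]
  ring_nf

variable {X : Type*} [MeasurableSpace X] {ν : Measure X} {u ψ : X → ℝ}

theorem integral_integral_cexp_mul_gaussianReal [SFinite ν] (hu : Measurable u)
    (hψ : Integrable ψ ν) :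
    ∫ ξ, ∫ x, Complex.exp (Complex.I * (ξ * u x : ℝ)) * ψ x ∂ν ∂gaussianReal 0 2 =
      (∫ x, Real.exp (-u x ^ 2) * ψ x ∂ν : ℝ) := by
  have hnorm : ∀ z : ℝ × X, ‖Complex.exp (Complex.I * (z.1 * u z.2 : ℝ))‖ ≤ 1 := fun z => by
    rw [mul_comm, Complex.norm_exp_ofReal_mul_I]
  have hint : Integrable (fun z : ℝ × X => Complex.exp (Complex.I * (z.1 * u z.2 : ℝ)) * ψ z.2)
      ((gaussianReal 0 2).prod ν) :=
    (hψ.ofReal (𝕜 := ℂ)).comp_snd _ |>.bdd_mul (by fun_prop) (ae_of_all _ hnorm)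
  have hchar : ∀ y : ℝ, ∫ ξ : ℝ, Complex.exp (Complex.I * (ξ * y : ℝ)) ∂gaussianReal 0 2 =
      Real.exp (-y ^ 2) := fun y => by
    have := charFun_gaussianReal (μ := 0) (v := 2) y
    rw [charFun_apply_real] at this
    convert this using 1
    · congr with ξ
      push_cast
      ring_nf
    · push_cast
      ring_nf
  rw [integral_integral_swap hint, ← integral_complex_ofReal]
  congr with x
  rw [integral_mul_const, hchar]
  push_cast
  rfl

theorem integral_exp_neg_sq_mul_le [SFinite ν] (hu : Measurable u) (hψ : Integrable ψ ν)
    {α B : ℝ} (hα : α < 1) (hB : ∀ ξ : ℝ, ξ ≠ 0 →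
      ‖∫ x, Complex.exp (Complex.I * (ξ * u x : ℝ)) * ψ x ∂ν‖ ≤ B * |ξ| ^ (-α)) :
    ∫ x, Real.exp (-u x ^ 2) * ψ x ∂ν ≤ B * ∫ ξ, |ξ| ^ (-α) ∂gaussianReal 0 2 := by
  have := nullSingletonClass_gaussianReal (μ := 0) (two_ne_zero (α := NNReal))
  have hne : ∀ᵐ ξ ∂gaussianReal 0 2, ξ ≠ 0 := by simp [ae_iff]
  calc ∫ x, Real.exp (-u x ^ 2) * ψ x ∂ν
      ≤ ‖((∫ x, Real.exp (-u x ^ 2) * ψ x ∂ν : ℝ) : ℂ)‖ := by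
        rw [Complex.norm_real]
        exact Real.le_norm_self _
    _ ≤ ∫ ξ, B * |ξ| ^ (-α) ∂gaussianReal 0 2 := by
        rw [← integral_integral_cexp_mul_gaussianReal hu hψ]
        exact norm_integral_le_of_norm_le
          ((integrable_abs_rpow_gaussianReal two_ne_zero (neg_lt_neg hα)).const_mul B)
          (hne.mono hB)
    _ = B * ∫ ξ, |ξ| ^ (-α) ∂gaussianReal 0 2 := integral_const_mul _ _

theorem measureReal_setOf_mem_Icc_le [IsFiniteMeasure ν] (hu : Measurable u) (hψ : Integrable ψ ν)
    {c : ℝ} (hc : 0 ≤ c) (hcψ : ∀ᵐ x ∂ν, c ≤ ψ x) :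
    Real.exp (-1) * c * ν.real {x | u x ∈ Set.Icc 0 1} ≤ ∫ x, Real.exp (-u x ^ 2) * ψ x ∂ν := by
  have hexp : ∀ x, Real.exp (-u x ^ 2) ≤ 1 := fun x => Real.exp_le_one_iff.2 (by nlinarith)
  have hint : Integrable (fun x => Real.exp (-u x ^ 2) * ψ x) ν :=
    hψ.bdd_mul (c := 1) (by fun_prop) (ae_of_all _ fun x => by simpa using hexp x)
  refine le_trans ?_ (mul_meas_ge_le_integral_of_nonneg
    (hcψ.mono fun x hx => mul_nonneg (Real.exp_pos _).le (hc.trans hx)) hint (Real.exp (-1) * c))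
  refine mul_le_mul_of_nonneg_left (ENNReal.toReal_mono (measure_ne_top ν _)
    (measure_mono_ae ?_)) (by positivity)
  filter_upwards [hcψ] with x hx hux
  have : -1 ≤ -u x ^ 2 := by nlinarith [hux.1, hux.2]
  exact mul_le_mul (Real.exp_le_exp.2 this) hx hc (Real.exp_pos _).le

end GaussianAverage

section FourierToSlab

open ProbabilityTheory

variable {n : ℕ} {S : Set (EuclideanSpace ℝ (Fin (n + 1)))}
  {ψ : EuclideanSpace ℝ (Fin (n + 1)) → ℝ} {α C C' c : ℝ}

theorem SlabBound.mono (h : SlabBound S α C) (hC : C ≤ C') : SlabBound S α C' := fun v hv t ht =>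
  (h v hv t ht).trans (by gcongr)

theorem norm_integral_cexp_affine_eq_norm_surfaceFourier (v : EuclideanSpace ℝ (Fin (n + 1)))
    (τ s ξ : ℝ) :
    ‖∫ x, Complex.exp (Complex.I * (ξ * (τ * (inner ℝ x v - s)) : ℝ)) * ψ x ∂surfaceMeasure S‖ =
      ‖surfaceFourier S ψ ((-(ξ * τ)) • v)‖ := by
  have phase : ∀ x, Complex.exp (Complex.I * (ξ * (τ * (inner ℝ x v - s)) : ℝ)) * ψ x =
      Complex.exp ((-(ξ * τ * s) : ℝ) * Complex.I) *
        (Complex.exp (-Complex.I * (inner ℝ ((-(ξ * τ)) • v) x : ℝ)) * ψ x) := fun x => by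
    rw [← mul_assoc (Complex.exp _) (Complex.exp _), ← Complex.exp_add, real_inner_smul_left,
      real_inner_comm]
    congr 2
    push_cast
    ring
  simp only [phase]
  rw [integral_const_mul, norm_mul, Complex.norm_exp_ofReal_mul_I, one_mul, surfaceFourier]

theorem FourierBound.norm_integral_cexp_affine_le (h : FourierBound S ψ α C')
    {v : EuclideanSpace ℝ (Fin (n + 1))} (hv : ‖v‖ = 1) {τ : ℝ} (hτ : 0 < τ) (s : ℝ) {ξ : ℝ}
    (hξ : ξ ≠ 0) :
    ‖∫ x, Complex.exp (Complex.I * (ξ * (τ * (inner ℝ x v - s)) : ℝ)) * ψ x ∂surfaceMeasure S‖ ≤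
      C' * τ ^ (-α) * |ξ| ^ (-α) := by
  have hv₀ : v ≠ 0 := norm_ne_zero_iff.1 (hv ▸ one_ne_zero)
  have hnorm : ‖(-(ξ * τ)) • v‖ = |ξ| * τ := by
    rw [norm_smul, hv, mul_one, norm_neg, norm_mul, Real.norm_eq_abs, Real.norm_of_nonneg hτ.le]
  rw [norm_integral_cexp_affine_eq_norm_surfaceFourier]
  calc ‖surfaceFourier S ψ ((-(ξ * τ)) • v)‖
      ≤ C' * ‖(-(ξ * τ)) • v‖ ^ (-α) :=
        h _ (smul_ne_zero (neg_ne_zero.2 (mul_ne_zero hξ hτ.ne')) hv₀)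
    _ = C' * τ ^ (-α) * |ξ| ^ (-α) := by
        rw [hnorm, Real.mul_rpow (abs_nonneg ξ) hτ.le]
        ring

theorem FourierBound.slabBound [IsFiniteMeasure (surfaceMeasure S)] (h : FourierBound S ψ α C')
    (hS : IsCompact S) (hα : α < 1) (hψ : ContinuousOn ψ S) (hc : 0 < c)
    (hcψ : ∀ x ∈ S, c ≤ ψ x) :
    SlabBound S α (C' * (∫ ξ, |ξ| ^ (-α) ∂gaussianReal 0 2) / (Real.exp (-1) * c)) := by
  intro v hv t ht
  refine iSup_le fun s => ?_
  have hτ : 0 < |t| := abs_pos.2 ht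
  have hu : Measurable fun x => |t| * (inner ℝ x v - s) := by fun_prop
  have hψi := integrable_surfaceMeasure_of_continuousOn hS hψ
  have hsub : {x | x ∈ S ∧ s ≤ inner ℝ x v ∧ inner ℝ x v ≤ s + |t|⁻¹} ⊆
      {x | |t| * (inner ℝ x v - s) ∈ Set.Icc 0 1} := fun x ⟨_, hsx, hxs⟩ =>
    ⟨mul_nonneg hτ.le (sub_nonneg.2 hsx),
      (le_inv_mul_iff₀ hτ).1 (by rw [mul_one]; exact sub_le_iff_le_add'.2 hxs)⟩
  have hreal : Real.exp (-1) * c *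
      (surfaceMeasure S).real {x | |t| * (inner ℝ x v - s) ∈ Set.Icc 0 1} ≤
        C' * |t| ^ (-α) * ∫ ξ, |ξ| ^ (-α) ∂gaussianReal 0 2 :=
    (measureReal_setOf_mem_Icc_le hu hψi hc.le
      (ae_restrict_of_forall_mem hS.measurableSet hcψ)).trans
      (integral_exp_neg_sq_mul_le hu hψi hα fun _ hξ => h.norm_integral_cexp_affine_le hv hτ s hξ)
  refine (measure_mono hsub).trans ?_
  rw [← ofReal_measureReal]
  refine ENNReal.ofReal_le_ofReal ?_
  rw [div_mul_eq_mul_div, le_div_iff₀' (by positivity)]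
  linarith

theorem FourierBound.exists_slabBound [IsFiniteMeasure (surfaceMeasure S)]
    (h : FourierBound S ψ α C') (hS : IsCompact S) (hα : α < 1) (hψ : ContinuousOn ψ S)
    (hψ₀ : ∀ x ∈ S, 0 < ψ x) : ∃ C : ℝ, 0 < C ∧ SlabBound S α C := by
  obtain ⟨c, hc, hcψ⟩ := hS.exists_forall_le' hψ hψ₀
  exact ⟨_, lt_max_of_lt_right one_pos, (h.slabBound hS hα hψ hc hcψ).mono (le_max_left _ 1)⟩

end FourierToSlab

theorem theorem1p4 (n : ℕ) (hn : 1 ≤ n) (S : Set (EuclideanSpace ℝ (Fin (n + 1))))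
    (hS_compact : IsCompact S) (hS_C2 : IsC2Hypersurface n S) (hS_convex : BoundsConvexDomain S)
    (α : ℝ) (hα0 : 0 < α) (hα1 : α < 1) :
    (∀ ψ : EuclideanSpace ℝ (Fin (n + 1)) → ℝ, IsC1Near S ψ →
      (∃ C : ℝ, 0 < C ∧ SlabBound S α C) → ∃ C' : ℝ, FourierBound S ψ α C') ∧
    (∃ C : ℝ, 0 < C ∧ ∀ ψ : EuclideanSpace ℝ (Fin (n + 1)) → ℝ, IsC1Near S ψ →
      (∀ x ∈ S, 0 < ψ x) → (∃ C' : ℝ, FourierBound S ψ α C') → SlabBound S α C) := by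
  have := hS_C2.isFiniteMeasure_surfaceMeasure hS_compact
  constructor
  · rintro ψ hψ ⟨C, hC, hslab⟩
    exact exists_fourierBound_of_locally hS_compact (fun p hp =>
      exists_nhds_forall_exists_fourierBound hS_compact.measurableSet hS_C2 hS_convex hα1 hC.le
        hslab hp) hψ
  · -- The slab bound does not mention `ψ`, so one admissible `ψ` supplies a constant for all.
    by_cases h : ∃ C : ℝ, 0 < C ∧ SlabBound S α C
    · obtain ⟨C, hC, hslab⟩ := h
      exact ⟨C, hC, fun _ _ _ _ => hslab⟩
    · refine ⟨1, one_pos, fun ψ hψ hψ₀ ⟨C', hF⟩ => absurd ?_ h⟩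
      exact hF.exists_slabBound hS_compact hα1 hψ.continuousOn hψ₀
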